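/- Let $N\ge 1$ be an integer, let $p\in(1,\infty)$, and let $B_1^c=\{x\in\mathbb R^N : |x|>1\}$ be the exterior of the closed unit ball. Let $g\in L^1_{loc}(B_1^c)$ be real-valued and set $$\tilde g(r)=\operatorname{ess\,sup}\{|g(r\omega)| : \omega\in S^{N-1}\}\in[0,\infty],\qquad r\in(1,\infty),$$ where the essential supremum is taken with respect to the surface measure on the unit sphere $S^{N-1}$. Let $X$ be the weighted space $$X=\begin{cases} L^1\big((1,\infty);\,r^{p-1}\big), & N\neq p,\\[2pt] L^1\big((1,\infty);\,(r(1+\log r))^{N-1}\big), & N=p.\end{cases}$$ Let $W^{1,p}(B_1^c)$ be the Sobolev space of real-valued functions $u\in L^p(B_1^c)$ with weak gradient $\nabla u\in L^p(B_1^c;\mathbb R^N)$, normed by $\|u\|=\big(\int_{B_1^c}|u|^p+\int_{B_1^c}|\nabla u|^p\big)^{1/p}$, and let $L^p(B_1^c,|g|)$ be the $L^p$ space of the measure $|g|\,dx$ on $B_1^c$. If $\tilde g\in X$, then $W^{1,p}(B_1^c)$ is compactly embedded in $L^p(B_1^c,|g|)$; that is, every $u\in W^{1,p}(B_1^c)$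 belongs to $L^p(B_1^c,|g|)$, and the linear map $u\mapsto u$ from $W^{1,p}(B_1^c)$ to $L^p(B_1^c,|g|)$ is bounded and compact. -/

import Mathlib

open MeasureTheory Set
open scoped ENNReal ContDiff

noncomputable section

namespace ExteriorBall

/-- The exterior `{x : 1 < ‖x‖}` of the closed unit ball of `ℝ^N`. -/
def exterior (N : ℕ) : Set (EuclideanSpace ℝ (Fin N)) :=
  (Metric.closedBall 0 1)ᶜ

/-- `G` is the weak (distributional) gradient of `u` on `Ω`: integration by parts against all
test functions in `C_c^∞(Ω)`. It is used for `u` and `G` in `L^p(Ω)`, so that the integrals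
below converge. -/
def HasWeakGradient {N : ℕ} (Ω : Set (EuclideanSpace ℝ (Fin N)))
    (u : EuclideanSpace ℝ (Fin N) → ℝ)
    (G : EuclideanSpace ℝ (Fin N) → EuclideanSpace ℝ (Fin N)) : Prop :=
  ∀ φ : EuclideanSpace ℝ (Fin N) → ℝ, ContDiff ℝ ∞ φ → HasCompactSupport φ → tsupport φ ⊆ Ω →
    ∀ i : Fin N,
      ∫ x in Ω, u x * fderiv ℝ φ x (EuclideanSpace.single i 1) = -∫ x in Ω, G x i * φ x

section Aux

variable {N : ℕ} {Ω : Set (EuclideanSpace ℝ (Fin N))} {p : ℝ≥0∞}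

theorem integrable_mul_test [Fact (1 ≤ p)] {f ψ : EuclideanSpace ℝ (Fin N) → ℝ}
    (hf : MemLp f p (volume.restrict Ω)) (hψ : Continuous ψ) (hc : HasCompactSupport ψ) :
    Integrable (fun x => f x * ψ x) (volume.restrict Ω) := by
  have hloc : LocallyIntegrable f (volume.restrict Ω) :=
    hf.locallyIntegrable Fact.out
  simpa [smul_eq_mul, mul_comm] using hloc.integrable_smul_left_of_hasCompactSupport hψ hc

theorem memLp_coord {G : EuclideanSpace ℝ (Fin N) → EuclideanSpace ℝ (Fin N)}
    (hG : MemLp G p (volume.restrict Ω)) (i : Fin N) :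
    MemLp (fun x => G x i) p (volume.restrict Ω) :=
  (EuclideanSpace.proj (𝕜 := ℝ) i : EuclideanSpace ℝ (Fin N) →L[ℝ] ℝ).comp_memLp' hG

theorem continuous_partial {φ : EuclideanSpace ℝ (Fin N) → ℝ} (hφ : ContDiff ℝ ∞ φ)
    (v : EuclideanSpace ℝ (Fin N)) : Continuous fun x => fderiv ℝ φ x v :=
  (hφ.continuous_fderiv (by simp)).clm_apply continuous_const

theorem hasCompactSupport_partial {φ : EuclideanSpace ℝ (Fin N) → ℝ} (hc : HasCompactSupport φ)
    (v : EuclideanSpace ℝ (Fin N)) : HasCompactSupport fun x => fderiv ℝ φ x v :=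
  hc.fderiv_apply ℝ v

end Aux

/-- The Sobolev space `W^{1,p}(Ω)` of real functions: all `u ∈ L^p(Ω)` having a weak gradient
`∇u ∈ L^p(Ω; ℝ^N)`. The function `u` is stored together with its weak gradient (which `u`
determines when `Ω` is open, see `sobolevSpace_ext`), so that the norm of the ambient space is
`‖u‖ = (∫_Ω |u|^p + ∫_Ω |∇u|^p)^{1/p}` for finite `p`. -/
def sobolevSpace {N : ℕ} (Ω : Set (EuclideanSpace ℝ (Fin N))) (p : ℝ≥0∞) [Fact (1 ≤ p)] :
    Submodule ℝ (WithLp p (Lp ℝ p (volume.restrict Ω) ×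
      Lp (EuclideanSpace ℝ (Fin N)) p (volume.restrict Ω))) where
  carrier := {w | HasWeakGradient Ω w.fst w.snd}
  zero_mem' := by
    intro φ _ _ _ i
    rw [integral_congr_ae (g := fun _ => (0 : ℝ)), integral_congr_ae
      (f := fun x => _ * φ x) (g := fun _ => (0 : ℝ))]
    · simp
    · filter_upwards [Lp.coeFn_zero (EuclideanSpace ℝ (Fin N)) p (volume.restrict Ω)] with x hx
      have hx' : (0 : WithLp p (Lp ℝ p (volume.restrict Ω) ×
        Lp (EuclideanSpace ℝ (Fin N)) p (volume.restrict Ω))).snd x = 0 := hx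
      rw [hx', PiLp.zero_apply, zero_mul]
    · filter_upwards [Lp.coeFn_zero ℝ p (volume.restrict Ω)] with x hx
      have hx' : (0 : WithLp p (Lp ℝ p (volume.restrict Ω) ×
        Lp (EuclideanSpace ℝ (Fin N)) p (volume.restrict Ω))).fst x = 0 := hx
      rw [hx', zero_mul]
  add_mem' := by
    intro a b ha hb φ h1 h2 h3 i
    have hA := ha φ h1 h2 h3 i
    have hB := hb φ h1 h2 h3 i
    have c1 := continuous_partial h1 (EuclideanSpace.single i 1)
    have c2 := hasCompactSupport_partial h2 (EuclideanSpace.single i 1)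
    have e1 : ∫ x in Ω, (a + b).fst x * fderiv ℝ φ x (EuclideanSpace.single i 1)
        = ∫ x in Ω, (a.fst x * fderiv ℝ φ x (EuclideanSpace.single i 1)
          + b.fst x * fderiv ℝ φ x (EuclideanSpace.single i 1)) := by
      refine integral_congr_ae ?_
      filter_upwards [Lp.coeFn_add a.fst b.fst] with x hx
      have hx' : (a + b).fst x = a.fst x + b.fst x := hx
      rw [hx', add_mul]
    have e2 : ∫ x in Ω, (a + b).snd x i * φ x
        = ∫ x in Ω, (a.snd x i * φ x + b.snd x i * φ x) := by
      refine integral_congr_ae ?_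
      filter_upwards [Lp.coeFn_add a.snd b.snd] with x hx
      have hx' : (a + b).snd x = a.snd x + b.snd x := hx
      rw [hx', PiLp.add_apply, add_mul]
    rw [e1, e2, integral_add (integrable_mul_test (Lp.memLp _) c1 c2)
        (integrable_mul_test (Lp.memLp _) c1 c2),
      integral_add (integrable_mul_test (memLp_coord (Lp.memLp _) i) h1.continuous h2)
        (integrable_mul_test (memLp_coord (Lp.memLp _) i) h1.continuous h2), hA, hB]
    ring
  smul_mem' := by
    intro c a ha φ h1 h2 h3 i
    have hA := ha φ h1 h2 h3 i
    have e1 : ∫ x in Ω, (c • a).fst x * fderiv ℝ φ x (EuclideanSpace.single i 1)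
        = ∫ x in Ω, c * (a.fst x * fderiv ℝ φ x (EuclideanSpace.single i 1)) := by
      refine integral_congr_ae ?_
      filter_upwards [Lp.coeFn_smul c a.fst] with x hx
      have hx' : (c • a).fst x = c * a.fst x := hx
      rw [hx', mul_assoc]
    have e2 : ∫ x in Ω, (c • a).snd x i * φ x = ∫ x in Ω, c * (a.snd x i * φ x) := by
      refine integral_congr_ae ?_
      filter_upwards [Lp.coeFn_smul c a.snd] with x hx
      have hx' : (c • a).snd x = c • a.snd x := hx
      rw [hx', PiLp.smul_apply, smul_eq_mul, mul_assoc]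
    rw [e1, e2, integral_const_mul, integral_const_mul, hA]
    ring

/-- On an open set an element of the Sobolev space is determined by its function part. -/
theorem sobolevSpace_ext {N : ℕ} {Ω : Set (EuclideanSpace ℝ (Fin N))} (hΩ : IsOpen Ω)
    {p : ℝ≥0∞} [Fact (1 ≤ p)] {v w : sobolevSpace Ω p} (h : v.1.fst = w.1.fst) : v = w := by
  have key : ∀ i : Fin N, ∀ᵐ x ∂(volume : Measure (EuclideanSpace ℝ (Fin N))),
      x ∈ Ω → v.1.snd x i - w.1.snd x i = 0 := by
    intro i
    have mv := memLp_coord (Lp.memLp v.1.snd) i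
    have mw := memLp_coord (Lp.memLp w.1.snd) i
    refine hΩ.ae_eq_zero_of_integral_contDiff_smul_eq_zero ?_ ?_
    · have := (mv.sub mw).locallyIntegrable (Fact.out : 1 ≤ p)
      exact locallyIntegrableOn_of_locallyIntegrable_restrict this
    · intro φ h1 h2 h3
      have hv := v.2 φ h1 h2 h3 i
      have hw := w.2 φ h1 h2 h3 i
      rw [h] at hv
      have hvw := neg_injective (hv.symm.trans hw)
      have h0 : ∫ x in Ω, φ x • (v.1.snd x i - w.1.snd x i) = 0 := by
        have : ∀ x, φ x • (v.1.snd x i - w.1.snd x i)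
            = v.1.snd x i * φ x - w.1.snd x i * φ x := by
          intro x; simp only [smul_eq_mul]; ring
        simp only [this]
        rw [integral_sub (integrable_mul_test mv h1.continuous h2)
          (integrable_mul_test mw h1.continuous h2), hvw, sub_self]
      rw [← h0]
      refine (setIntegral_eq_integral_of_forall_compl_eq_zero ?_).symm
      intro x hx
      have : φ x = 0 := by
        by_contra hne
        exact hx (h3 (subset_tsupport _ hne))
      simp [this]
  have hs : v.1.snd = w.1.snd := by
    refine Lp.ext ?_
    have := (ae_all_iff.2 key)
    filter_upwards [ae_restrict_of_ae this, ae_restrict_mem hΩ.measurableSet] with x hx hxΩ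
    ext i
    exact sub_eq_zero.1 (hx i hxΩ)
  refine Subtype.ext ?_
  exact (WithLp.equiv p _).injective (Prod.ext h hs)

/-- The radial envelope `g̃(r) = ess sup {|g(rω)| : ω ∈ S^{N-1}}`, with values in `[0, ∞]`, the
essential supremum being taken with respect to the surface measure of the unit sphere. -/
def radialEnvelope {N : ℕ} (g : EuclideanSpace ℝ (Fin N) → ℝ) (r : ℝ) : ℝ≥0∞ :=
  essSup (fun θ : Metric.sphere (0 : EuclideanSpace ℝ (Fin N)) 1 =>
      ‖g (r • (θ : EuclideanSpace ℝ (Fin N)))‖ₑ)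
    (volume : Measure (EuclideanSpace ℝ (Fin N))).toSphere

/-- The weight on `(1, ∞)` that defines the space `X`. -/
def radialWeight (N : ℕ) (p : ℝ≥0∞) (r : ℝ) : ℝ :=
  if (N : ℝ≥0∞) = p then (r * (1 + Real.log r)) ^ ((N : ℝ) - 1) else r ^ (p.toReal - 1)

/-- Membership in the weighted space `X`: `L^1((1,∞); r^{p-1})` if `N ≠ p`, and
`L^1((1,∞); (r(1 + log r))^{N-1})` if `N = p`. -/
def MemX (N : ℕ) (p : ℝ≥0∞) (f : ℝ → ℝ≥0∞) : Prop :=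
  MemLp f 1 ((volume.restrict (Ioi (1 : ℝ))).withDensity
    fun r => ENNReal.ofReal (radialWeight N p r))

/-- The measure `|g| dx` on the exterior of the closed unit ball. -/
def weightMeasure {N : ℕ} (g : EuclideanSpace ℝ (Fin N) → ℝ) :
    Measure (EuclideanSpace ℝ (Fin N)) :=
  (volume.restrict (exterior N)).withDensity fun x => ‖g x‖ₑ

end ExteriorBall

end

noncomputable section

namespace ExteriorBall

open Filter Topology

/-! The weights defining `X` are at least `1` for `r > 1`, so the envelope of `g` is integrable on
`(1, ∞)` for plain Lebesgue measure. Hence `|g(x)| ≤ γ(‖x‖)` almost everywhere, with `γ` measurable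
and `∫₁^∞ γ < ∞` (`exists_radial_majorant`). Nothing else about `X` is needed, because the norm
controls `u` itself as well as its gradient.

Boundedness is a one-dimensional trace estimate on rays. The value `u(rθ)` is bounded by the
integral of `|u| + |∇u|` over the segment of radii `[r, r + 1]`. This segment points outward, so it
stays in the domain and no extension across the unit sphere is needed. Jensen and `r^(N-1) ≤
s^(N-1)` bound `r^(N-1) |u(rθ)|^p` by `2^(p-1)` times the energy on the whole ray, a quantity
independent of `r`. Integrating against `γ(r)` and then over `θ` gives `∫ γ(‖x‖) |u|^p ≤ 2^(p-1) (∫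
γ) ‖u‖^p` (`lintegral_radial_weight_le`). Mollification and Fatou carry this from `C¹` functions to
Sobolev functions.

For compactness, the embedding is an operator norm limit of finite rank operators. Keep only the
radii in `[1 + 1/(n+1), n]` where `γ ≤ n`. The discarded part is the same weighted estimate with the
tail of `γ`, which is small by dominated convergence. On the kept part, replace `u(x)` by its
average over a ball of radius `h` about one of finitely many centres near `x`. The translation
estimate `‖u - u(· - z)‖_p ≤ ‖z‖ ‖∇u‖_p` makes the `p`-th power of the error at most a constant
times `n h^p ‖u‖^p` (`lintegral_sub_average_le`). First `n`, then `h`, is chosen. -/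

/-- Jensen's inequality for powers and a probability measure. -/
theorem rpow_lintegral_le {α : Type*} [MeasurableSpace α] (μ : Measure α)
    [IsProbabilityMeasure μ] {f : α → ℝ≥0∞} (hf : AEMeasurable f μ) {q : ℝ} (hq : 1 ≤ q) :
    (∫⁻ x, f x ∂μ) ^ q ≤ ∫⁻ x, f x ^ q ∂μ := by
  have h := eLpNorm'_le_eLpNorm'_of_exponent_le zero_lt_one hq μ hf.aestronglyMeasurable
  simp only [eLpNorm', enorm_eq_self, ENNReal.rpow_one, div_one] at h
  calc (∫⁻ x, f x ∂μ) ^ q ≤ ((∫⁻ x, f x ^ q ∂μ) ^ (1 / q)) ^ q := by gcongr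
    _ = _ := by rw [← ENNReal.rpow_mul, one_div_mul_cancel (by positivity), ENNReal.rpow_one]

/-- Jensen's inequality for powers and a weight of integral one. -/
theorem rpow_lintegral_mul_le {α : Type*} [MeasurableSpace α] {μ : Measure α}
    {k f : α → ℝ≥0∞} (hk : Measurable k) (hk1 : ∫⁻ x, k x ∂μ = 1) (hf : Measurable f)
    {q : ℝ} (hq : 1 ≤ q) :
    (∫⁻ x, k x * f x ∂μ) ^ q ≤ ∫⁻ x, k x * f x ^ q ∂μ := by
  have : IsProbabilityMeasure (μ.withDensity k) := ⟨by simp [hk1]⟩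
  have h := rpow_lintegral_le (μ.withDensity k) hf.aemeasurable hq
  rw [lintegral_withDensity_eq_lintegral_mul _ hk hf,
    lintegral_withDensity_eq_lintegral_mul _ hk (hf.pow_const q)] at h
  simpa using h

/-! ### Averaging and polar coordinates for Haar measures -/

section Haar

variable {E : Type*} [NormedAddCommGroup E] [NormedSpace ℝ E] [FiniteDimensional ℝ E]
  [MeasurableSpace E] [BorelSpace E]

/-- Averaging against a kernel of integral one does not increase the `L^q` norm. -/
theorem lintegral_rpow_convolution_le (μ : Measure E) [μ.IsAddHaarMeasure]
    {k f : E → ℝ≥0∞} (hk : Measurable k) (hk1 : ∫⁻ x, k x ∂μ = 1) (hf : Measurable f)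
    {q : ℝ} (hq : 1 ≤ q) :
    ∫⁻ x, (∫⁻ y, k y * f (x - y) ∂μ) ^ q ∂μ ≤ ∫⁻ x, f x ^ q ∂μ := by
  calc ∫⁻ x, (∫⁻ y, k y * f (x - y) ∂μ) ^ q ∂μ
      ≤ ∫⁻ x, ∫⁻ y, k y * f (x - y) ^ q ∂μ ∂μ := by
        refine lintegral_mono fun x => ?_
        exact rpow_lintegral_mul_le hk hk1 (hf.comp (measurable_const.sub measurable_id)) hq
    _ = ∫⁻ y, ∫⁻ x, k y * f (x - y) ^ q ∂μ ∂μ := by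
        refine lintegral_lintegral_swap (Measurable.aemeasurable ?_)
        exact (hk.comp measurable_snd).mul
          ((hf.comp (measurable_fst.sub measurable_snd)).pow_const q)
    _ = ∫⁻ y, k y * ∫⁻ x, f x ^ q ∂μ ∂μ := by
        refine lintegral_congr fun y => ?_
        have hm : Measurable fun x => f (x - y) ^ q :=
          (hf.comp (measurable_id.sub measurable_const)).pow_const q
        rw [lintegral_const_mul _ hm]
        congr 1
        exact lintegral_sub_right_eq_self (fun x => f x ^ q) y
    _ = ∫⁻ x, f x ^ q ∂μ := by
        rw [lintegral_mul_const _ hk, hk1, one_mul]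

/-- Integration in polar coordinates. -/
theorem lintegral_polar [Nontrivial E] (μ : Measure E) [μ.IsAddHaarMeasure] {f : E → ℝ≥0∞}
    (hf : Measurable f) :
    ∫⁻ x, f x ∂μ = ∫⁻ θ : Metric.sphere (0 : E) 1, ∫⁻ r in Ioi (0 : ℝ),
      ENNReal.ofReal (r ^ (Module.finrank ℝ E - 1)) * f (r • (θ : E)) ∂volume ∂μ.toSphere := by
  have h := μ.measurePreserving_homeomorphUnitSphereProd.lintegral_comp_emb
    (Homeomorph.measurableEmbedding _)
    (fun z : Metric.sphere (0 : E) 1 × Ioi (0 : ℝ) => f ((z.2 : ℝ) • (z.1 : E)))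
  have h1 : ∀ x : ({0}ᶜ : Set E), (((homeomorphUnitSphereProd E x).2 : ℝ) •
      ((homeomorphUnitSphereProd E x).1 : E)) = x := by
    intro x
    have := (homeomorphUnitSphereProd E).symm_apply_apply x
    conv_rhs => rw [← this]
    rfl
  simp only [h1] at h
  have h2 : ∫⁻ x, f x ∂μ = ∫⁻ x : ({0}ᶜ : Set E), f x ∂(μ.comap (↑)) := by
    rw [lintegral_subtype_comap (measurableSet_singleton _).compl, restrict_compl_singleton]
  rw [h2, h, lintegral_prod]
  · refine lintegral_congr fun θ => ?_
    rw [Measure.volumeIoiPow, lintegral_withDensity_eq_lintegral_mul]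
    · rw [← lintegral_subtype_comap measurableSet_Ioi]
      rfl
    · fun_prop
    · exact hf.comp (by fun_prop)
  · exact (hf.comp (by fun_prop)).aemeasurable

end Haar

/-! ### Estimates along segments for `C¹` functions -/

section Smooth

variable {E : Type*} [NormedAddCommGroup E] [NormedSpace ℝ E] {V : E → ℝ}

theorem enorm_sub_le_lintegral_fderiv_line (hV : ContDiff ℝ 1 V) (x v : E) {a b : ℝ}
    (hab : a ≤ b) :
    ‖V (x + b • v) - V (x + a • v)‖ₑ ≤ ∫⁻ t in Icc a b, ‖fderiv ℝ V (x + t • v)‖ₑ * ‖v‖ₑ := by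
  have hline : ∀ t : ℝ, HasDerivAt (fun t : ℝ => x + t • v) v t := fun t => by
    simpa using ((hasDerivAt_id t).smul_const v).const_add x
  have hC : ContDiff ℝ 1 fun t : ℝ => V (x + t • v) := hV.comp (by fun_prop)
  refine (enorm_sub_le_lintegral_deriv_of_contDiffOn_Icc hC.contDiffOn hab).trans ?_
  refine lintegral_mono fun t => ?_
  have hd : HasDerivAt (fun t : ℝ => V (x + t • v)) (fderiv ℝ V (x + t • v) v) t :=
    ((hV.differentiable one_ne_zero) _).hasFDerivAt.comp_hasDerivAt t (hline t)
  rw [hd.deriv]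
  exact ContinuousLinearMap.le_opENorm _ _

/-- A radial trace inequality: the value at radius `r` is controlled by the values of the
function and of its gradient on the segment `[r, r + 1]`. -/
theorem enorm_le_lintegral_radial (hV : ContDiff ℝ 1 V) {v : E} (hv : ‖v‖ = 1) (r : ℝ) :
    ‖V (r • v)‖ₑ ≤ ∫⁻ s in Icc r (r + 1), (‖V (s • v)‖ₑ + ‖fderiv ℝ V (s • v)‖ₑ) := by
  have hv' : ‖v‖ₑ = 1 := by rw [← ofReal_norm, hv, ENNReal.ofReal_one]
  have hm : Measurable fun s : ℝ => ‖V (s • v)‖ₑ :=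
    (hV.continuous.comp (by fun_prop : Continuous fun s : ℝ => s • v)).enorm.measurable
  set D := ∫⁻ s in Icc r (r + 1), ‖fderiv ℝ V (s • v)‖ₑ with hD
  have hle : ∀ s ∈ Icc r (r + 1), ‖V (r • v)‖ₑ ≤ ‖V (s • v)‖ₑ + D := by
    intro s hs
    have h1 := enorm_sub_le_lintegral_fderiv_line hV 0 v hs.1
    simp only [zero_add, hv', mul_one] at h1
    have h2 : ∫⁻ t in Icc r s, ‖fderiv ℝ V (t • v)‖ₑ ≤ D :=
      lintegral_mono_set (Icc_subset_Icc_right hs.2)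
    calc ‖V (r • v)‖ₑ = ‖V (s • v) - (V (s • v) - V (r • v))‖ₑ := by congr 1; ring
      _ ≤ ‖V (s • v)‖ₑ + ‖V (s • v) - V (r • v)‖ₑ := enorm_sub_le
      _ ≤ _ := by gcongr; exact h1.trans h2
  -- The segment has length one, so averaging over `s` costs no constant and Jensen applies directly
  -- later.
  have hvol : volume (Icc r (r + 1)) = 1 := by simp
  calc ‖V (r • v)‖ₑ = ∫⁻ _ in Icc r (r + 1), ‖V (r • v)‖ₑ := by simp
    _ ≤ ∫⁻ s in Icc r (r + 1), (‖V (s • v)‖ₑ + D) :=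
        setLIntegral_mono' measurableSet_Icc hle
    _ = _ := by
        rw [lintegral_add_left hm, lintegral_add_left hm, setLIntegral_const, hvol, mul_one]

/-- Jensen on the unit interval moves the power inside the trace inequality, and `r ≤ s` lets the
polar Jacobian `r ^ n` be replaced by `s ^ n` under the integral. The factor `2 ^ (q - 1)` comes
from splitting the power of the sum. -/
theorem rpow_enorm_le_lintegral_radial (hV : ContDiff ℝ 1 V) {v : E} (hv : ‖v‖ = 1)
    {q : ℝ} (hq : 1 ≤ q) {r : ℝ} (hr : 0 ≤ r) (n : ℕ) :
    ENNReal.ofReal (r ^ n) * ‖V (r • v)‖ₑ ^ q ≤ 2 ^ (q - 1) * ∫⁻ s in Icc r (r + 1),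
      ENNReal.ofReal (s ^ n) * (‖V (s • v)‖ₑ ^ q + ‖fderiv ℝ V (s • v)‖ₑ ^ q) := by
  have hprob : IsProbabilityMeasure (volume.restrict (Icc r (r + 1))) := ⟨by simp⟩
  have hc : Continuous fun s : ℝ => s • v := by fun_prop
  have hm1 : Measurable fun s : ℝ => ‖V (s • v)‖ₑ := (hV.continuous.comp hc).enorm.measurable
  have hm2 : Measurable fun s : ℝ => ‖fderiv ℝ V (s • v)‖ₑ :=
    ((hV.continuous_fderiv one_ne_zero).comp hc).enorm.measurable
  calc ENNReal.ofReal (r ^ n) * ‖V (r • v)‖ₑ ^ q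
      ≤ ENNReal.ofReal (r ^ n) *
        (∫⁻ s in Icc r (r + 1), (‖V (s • v)‖ₑ + ‖fderiv ℝ V (s • v)‖ₑ)) ^ q := by
        gcongr; exact enorm_le_lintegral_radial hV hv r
    _ ≤ ENNReal.ofReal (r ^ n) *
        ∫⁻ s in Icc r (r + 1), (‖V (s • v)‖ₑ + ‖fderiv ℝ V (s • v)‖ₑ) ^ q := by
        gcongr; exact rpow_lintegral_le _ (hm1.add hm2).aemeasurable hq
    _ = ∫⁻ s in Icc r (r + 1),
        ENNReal.ofReal (r ^ n) * (‖V (s • v)‖ₑ + ‖fderiv ℝ V (s • v)‖ₑ) ^ q := by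
        have hm : Measurable fun s : ℝ => (‖V (s • v)‖ₑ + ‖fderiv ℝ V (s • v)‖ₑ) ^ q :=
          (hm1.add hm2).pow_const q
        rw [lintegral_const_mul _ hm]
    _ ≤ ∫⁻ s in Icc r (r + 1), 2 ^ (q - 1) *
        (ENNReal.ofReal (s ^ n) * (‖V (s • v)‖ₑ ^ q + ‖fderiv ℝ V (s • v)‖ₑ ^ q)) := by
        refine setLIntegral_mono' measurableSet_Icc fun s hs => ?_
        rw [mul_left_comm]
        gcongr
        · exact hs.1
        · exact ENNReal.rpow_add_le_mul_rpow_add_rpow _ _ hq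
    _ = _ := by
        refine lintegral_const_mul _ ?_
        exact (by fun_prop : Measurable fun s : ℝ => ENNReal.ofReal (s ^ n)).mul
          ((hm1.pow_const q).add (hm2.pow_const q))

variable [FiniteDimensional ℝ E] [MeasurableSpace E] [BorelSpace E]

/-- A radial weight of finite mass on `(a, ∞)` embeds `W^{1,q}` into the weighted `L^q` space:
the case of smooth functions. -/
theorem lintegral_radial_weight_le_of_contDiff [Nontrivial E] (μ : Measure E) [μ.IsAddHaarMeasure]
    (hV : ContDiff ℝ 1 V) {q : ℝ} (hq : 1 ≤ q) {γ : ℝ → ℝ≥0∞} (hγ : Measurable γ) (a : ℝ) :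
    ∫⁻ x in {x : E | a < ‖x‖}, γ ‖x‖ * ‖V x‖ₑ ^ q ∂μ ≤ 2 ^ (q - 1) * (∫⁻ r in Ioi a, γ r) *
      ∫⁻ x in {x : E | a < ‖x‖}, (‖V x‖ₑ ^ q + ‖fderiv ℝ V x‖ₑ ^ q) ∂μ := by
  have hS : MeasurableSet {x : E | a < ‖x‖} := measurableSet_lt measurable_const measurable_norm
  have hm1 : Measurable fun x => ‖V x‖ₑ ^ q := hV.continuous.enorm.measurable.pow_const q
  have hm2 : Measurable fun x => ‖fderiv ℝ V x‖ₑ ^ q :=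
    (hV.continuous_fderiv one_ne_zero).enorm.measurable.pow_const q
  set H : E → ℝ≥0∞ := fun x => ‖V x‖ₑ ^ q + ‖fderiv ℝ V x‖ₑ ^ q with hH
  have hmH : Measurable H := hm1.add hm2
  set n := Module.finrank ℝ E - 1
  have hmγ : Measurable fun x : E => γ ‖x‖ * ‖V x‖ₑ ^ q := (hγ.comp measurable_norm).mul hm1
  rw [← lintegral_indicator hS, ← lintegral_indicator hS,
    lintegral_polar μ (hmγ.indicator hS),
    lintegral_polar μ (hmH.indicator hS)]
  have hK : Measurable fun θ : Metric.sphere (0 : E) 1 => ∫⁻ r in Ioi (0 : ℝ),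
      ENNReal.ofReal (r ^ n) * {x : E | a < ‖x‖}.indicator H (r • (θ : E)) := by
    refine Measurable.lintegral_prod_right' (ν := volume.restrict (Ioi (0 : ℝ)))
      (f := fun z : Metric.sphere (0 : E) 1 × ℝ =>
        ENNReal.ofReal (z.2 ^ n) * {x : E | a < ‖x‖}.indicator H (z.2 • (z.1 : E))) ?_
    exact (by fun_prop : Measurable fun z : Metric.sphere (0 : E) 1 × ℝ =>
      ENNReal.ofReal (z.2 ^ n)).mul ((hmH.indicator hS).comp (by fun_prop))
  rw [← lintegral_const_mul _ hK]
  refine lintegral_mono fun θ => ?_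
  have hθ : ‖(θ : E)‖ = 1 := by simp
  have hn : ∀ r : ℝ, 0 < r → ‖r • (θ : E)‖ = r := fun r hr => by
    rw [norm_smul, hθ, mul_one, Real.norm_of_nonneg hr.le]
  -- `K` is the energy on the whole ray beyond `a`. It bounds the trace at every radius `r > a`, so
  -- `γ` enters only through its total mass.
  set K := ∫⁻ r in Ioi (0 : ℝ),
      ENNReal.ofReal (r ^ n) * {x : E | a < ‖x‖}.indicator H (r • (θ : E)) with hKdef
  calc ∫⁻ r in Ioi (0 : ℝ), ENNReal.ofReal (r ^ n) *
        {x : E | a < ‖x‖}.indicator (fun x => γ ‖x‖ * ‖V x‖ₑ ^ q) (r • (θ : E))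
      ≤ ∫⁻ r in Ioi (0 : ℝ), (Ioi a).indicator γ r * (2 ^ (q - 1) * K) := by
        refine setLIntegral_mono' measurableSet_Ioi fun r hr => ?_
        by_cases har : a < r
        · rw [indicator_of_mem (by simpa [hn r hr] using har), hn r hr,
            indicator_of_mem (by simpa using har), mul_left_comm]
          refine mul_le_mul' le_rfl ?_
          refine (rpow_enorm_le_lintegral_radial hV hθ hq (le_of_lt hr) n).trans ?_
          gcongr
          rw [hKdef]
          refine le_trans ?_ (lintegral_mono_set (fun s hs => hr.trans_le hs.1 :
            Icc r (r + 1) ⊆ Ioi 0))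
          refine setLIntegral_mono' measurableSet_Icc fun s hs => ?_
          have hs0 : 0 < s := lt_of_lt_of_le hr hs.1
          rw [indicator_of_mem (by simpa [hn s hs0] using har.trans_le hs.1)]
        · rw [indicator_of_notMem (by simpa [hn r hr] using har)]
          simp
    _ ≤ ∫⁻ r, (Ioi a).indicator γ r * (2 ^ (q - 1) * K) := setLIntegral_le_lintegral _ _
    _ = _ := by
        rw [lintegral_mul_const _ (hγ.indicator measurableSet_Ioi),
          lintegral_indicator measurableSet_Ioi]
        ring

/-- The difference is an integral of the gradient over the segment from `x` to `x - z`. After Jensen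
in the segment parameter and Tonelli, translation invariance removes the shift. Cutting the gradient
off outside `B` loses nothing, since the segments from `A` stay in `B`. -/
theorem lintegral_sub_translate_le_of_contDiff (μ : Measure E) [μ.IsAddHaarMeasure]
    (hV : ContDiff ℝ 1 V) {q : ℝ} (hq : 1 ≤ q) {A B : Set E} (hA : MeasurableSet A)
    (hB : MeasurableSet B) {z : E} (hAB : ∀ x ∈ A, ∀ t ∈ Icc (0 : ℝ) 1, x - t • z ∈ B) :
    ∫⁻ x in A, ‖V x - V (x - z)‖ₑ ^ q ∂μ ≤ ‖z‖ₑ ^ q * ∫⁻ x in B, ‖fderiv ℝ V x‖ₑ ^ q ∂μ := by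
  have hprob : IsProbabilityMeasure (volume.restrict (Icc (0 : ℝ) 1)) := ⟨by simp⟩
  set D : E → ℝ≥0∞ := B.indicator fun x => ‖fderiv ℝ V x‖ₑ ^ q
  have hD : Measurable D :=
    ((hV.continuous_fderiv one_ne_zero).enorm.measurable.pow_const q).indicator hB
  calc ∫⁻ x in A, ‖V x - V (x - z)‖ₑ ^ q ∂μ
      ≤ ∫⁻ x in A, ∫⁻ t in Icc (0 : ℝ) 1, D (x - t • z) * ‖z‖ₑ ^ q ∂volume ∂μ := by
        refine setLIntegral_mono' hA fun x hx => ?_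
        have h := enorm_sub_le_lintegral_fderiv_line hV x (-z) (zero_le_one (α := ℝ))
        have h1 : ‖V x - V (x - z)‖ₑ ≤ ∫⁻ t in Icc (0 : ℝ) 1,
            ‖fderiv ℝ V (x - t • z)‖ₑ * ‖z‖ₑ := by
          rw [enorm_sub_rev]
          simpa [← sub_eq_add_neg] using h
        refine (ENNReal.rpow_le_rpow h1 (by positivity)).trans ?_
        refine (rpow_lintegral_le _ (Measurable.aemeasurable ?_) hq).trans ?_
        · exact (((hV.continuous_fderiv one_ne_zero).comp
            (by fun_prop : Continuous fun t : ℝ => x - t • z)).enorm.measurable).mul_const _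
        · refine setLIntegral_mono' measurableSet_Icc fun t ht => ?_
          rw [ENNReal.mul_rpow_of_nonneg _ _ (by positivity)]
          simp only [D]
          rw [indicator_of_mem (hAB x hx t ht)]
    _ ≤ ∫⁻ x, ∫⁻ t in Icc (0 : ℝ) 1, D (x - t • z) * ‖z‖ₑ ^ q ∂volume ∂μ :=
        setLIntegral_le_lintegral _ _
    _ = ∫⁻ t in Icc (0 : ℝ) 1, ∫⁻ x, D (x - t • z) * ‖z‖ₑ ^ q ∂μ := by
        refine lintegral_lintegral_swap (Measurable.aemeasurable ?_)
        exact (hD.comp (by fun_prop)).mul_const _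
    _ = ∫⁻ _ in Icc (0 : ℝ) 1, (∫⁻ x, D x ∂μ) * ‖z‖ₑ ^ q := by
        refine lintegral_congr fun t => ?_
        have hm : Measurable fun x => D (x - t • z) := hD.comp (by fun_prop)
        rw [lintegral_mul_const _ hm, lintegral_sub_right_eq_self D (t • z)]
    _ = _ := by
        rw [lintegral_const]
        simp only [D, measure_univ, mul_one]
        rw [lintegral_indicator hB, mul_comm]

end Smooth

/-! ### The exterior domain and mollification of Sobolev functions -/

theorem isOpen_exterior (N : ℕ) : IsOpen (exterior N) := Metric.isClosed_closedBall.isOpen_compl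

theorem mem_exterior {N : ℕ} {x : EuclideanSpace ℝ (Fin N)} : x ∈ exterior N ↔ 1 < ‖x‖ := by
  simp [exterior]

section Mollify

variable {N : ℕ}

/-- The mollification of `f` by a normed bump function. -/
def mollify (φ : ContDiffBump (0 : EuclideanSpace ℝ (Fin N)))
    (f : EuclideanSpace ℝ (Fin N) → ℝ) : EuclideanSpace ℝ (Fin N) → ℝ :=
  convolution f (φ.normed volume) (ContinuousLinearMap.mul ℝ ℝ) volume

variable {φ : ContDiffBump (0 : EuclideanSpace ℝ (Fin N))} {f : EuclideanSpace ℝ (Fin N) → ℝ}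

/-- Differentiation wants the smooth kernel on the right; almost everywhere convergence and the
pointwise bounds want it on the left. -/
theorem mollify_eq_convolution (φ : ContDiffBump (0 : EuclideanSpace ℝ (Fin N)))
    (f : EuclideanSpace ℝ (Fin N) → ℝ) :
    mollify φ f = convolution (φ.normed volume) f (ContinuousLinearMap.lsmul ℝ ℝ) volume := by
  ext x
  rw [convolution_eq_swap, mollify, convolution_def]
  simp [mul_comm]

theorem contDiff_mollify (φ : ContDiffBump (0 : EuclideanSpace ℝ (Fin N)))
    (hf : LocallyIntegrable f) : ContDiff ℝ 1 (mollify φ f) :=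
  φ.hasCompactSupport_normed.contDiff_convolution_right (n := 1) _ hf φ.contDiff_normed

theorem lintegral_normed (φ : ContDiffBump (0 : EuclideanSpace ℝ (Fin N))) :
    ∫⁻ y, ‖φ.normed volume y‖ₑ = 1 := by
  have h := φ.integral_normed (μ := volume)
  have h2 : ∫⁻ y, ‖φ.normed volume y‖ₑ = ∫⁻ y, ENNReal.ofReal (φ.normed volume y) :=
    lintegral_congr fun y => Real.enorm_of_nonneg (φ.nonneg_normed y)
  rw [h2, ← ofReal_integral_eq_lintegral_ofReal φ.integrable_normed
    (Filter.Eventually.of_forall φ.nonneg_normed), h, ENNReal.ofReal_one]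

theorem enorm_mollify_le (φ : ContDiffBump (0 : EuclideanSpace ℝ (Fin N)))
    (f : EuclideanSpace ℝ (Fin N) → ℝ) (x : EuclideanSpace ℝ (Fin N)) :
    ‖mollify φ f x‖ₑ ≤ ∫⁻ y, ‖φ.normed volume y‖ₑ * ‖f (x - y)‖ₑ := by
  rw [mollify_eq_convolution, convolution_def]
  refine (enorm_integral_le_lintegral_enorm _).trans_eq ?_
  simp

theorem fderiv_mollify_apply (φ : ContDiffBump (0 : EuclideanSpace ℝ (Fin N)))
    (hf : LocallyIntegrable f) (x v : EuclideanSpace ℝ (Fin N)) :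
    fderiv ℝ (mollify φ f) x v = ∫ y, f y * fderiv ℝ (φ.normed volume) (x - y) v := by
  have hc := φ.hasCompactSupport_normed (μ := volume)
  have hd : ContDiff ℝ 1 (φ.normed (volume : Measure (EuclideanSpace ℝ (Fin N)))) :=
    φ.contDiff_normed (n := 1)
  rw [mollify, (hc.hasFDerivAt_convolution_right (ContinuousLinearMap.mul ℝ ℝ) hf hd x).fderiv,
    convolution_precompR_apply _ hf (hc.fderiv ℝ) (hd.continuous_fderiv one_ne_zero),
    convolution_def]
  rfl

/-- The reflected kernel `y ↦ φ(x - y)` is supported in the closed ball about `x`, which lies in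
`Ω`, so it is an admissible test function. The jump of the zero extension at the boundary of `Ω` is
therefore not seen. -/
theorem fderiv_mollify_single {G : EuclideanSpace ℝ (Fin N) → EuclideanSpace ℝ (Fin N)}
    {Ω : Set (EuclideanSpace ℝ (Fin N))} (hΩ : MeasurableSet Ω)
    (φ : ContDiffBump (0 : EuclideanSpace ℝ (Fin N))) (hf : LocallyIntegrable (Ω.indicator f))
    (hG : HasWeakGradient Ω f G) {x : EuclideanSpace ℝ (Fin N)}
    (hx : Metric.closedBall x φ.rOut ⊆ Ω) (i : Fin N) :
    fderiv ℝ (mollify φ (Ω.indicator f)) x (EuclideanSpace.single i 1) =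
      ∫ y, φ.normed volume y * Ω.indicator G (x - y) i := by
  set ψ : EuclideanSpace ℝ (Fin N) → ℝ := fun y => φ.normed volume (x - y) with hψ
  have hφd : ContDiff ℝ ∞ (φ.normed (volume : Measure (EuclideanSpace ℝ (Fin N)))) :=
    φ.contDiff_normed (n := ⊤)
  have hψd : ContDiff ℝ ∞ ψ := hφd.comp (contDiff_const.sub contDiff_id)
  have hψs : ∀ y, ψ y ≠ 0 → y ∈ Metric.closedBall x φ.rOut := by
    intro y hy
    have : x - y ∈ Function.support (φ.normed volume) := hy
    rw [φ.support_normed_eq, mem_ball_zero_iff] at this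
    rw [Metric.mem_closedBall, dist_comm, dist_eq_norm]
    exact this.le
  have hts : tsupport ψ ⊆ Metric.closedBall x φ.rOut :=
    closure_minimal hψs Metric.isClosed_closedBall
  have hcs : HasCompactSupport ψ :=
    (isCompact_closedBall x φ.rOut).of_isClosed_subset (isClosed_tsupport ψ) hts
  have hder : ∀ y, fderiv ℝ ψ y (EuclideanSpace.single i 1) =
      -fderiv ℝ (φ.normed volume) (x - y) (EuclideanSpace.single i 1) := by
    intro y
    have h1 : HasFDerivAt (φ.normed volume) (fderiv ℝ (φ.normed volume) (x - y)) (x - y) :=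
      (hφd.differentiable (by simp) _).hasFDerivAt
    have h2 := h1.comp y ((hasFDerivAt_const x y).sub (hasFDerivAt_id y))
    have h3 : fderiv ℝ ψ y = _ := h2.fderiv
    rw [h3]
    simp
  have h := hG ψ hψd hcs (hts.trans hx) i
  rw [fderiv_mollify_apply φ hf]
  have h4 : ∫ y, Ω.indicator f y * fderiv ℝ (φ.normed volume) (x - y) (EuclideanSpace.single i 1)
      = -∫ y in Ω, f y * fderiv ℝ ψ y (EuclideanSpace.single i 1) := by
    rw [← integral_indicator hΩ, ← integral_neg]
    refine integral_congr_ae (Filter.Eventually.of_forall fun y => ?_)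
    by_cases hy : y ∈ Ω <;> simp [hy, hder]
  rw [h4, h, neg_neg, ← integral_indicator hΩ, ← integral_sub_left_eq_self _ volume x]
  refine integral_congr_ae (Filter.Eventually.of_forall fun y => ?_)
  by_cases hy : x - y ∈ Ω <;> simp [hy, hψ, mul_comm]

/-- The partial derivatives are the coordinates of one vector-valued average `W` of the weak
gradient, so the derivative is the inner product with `W`. Comparing full norms in this way avoids a
dimensional constant. -/
theorem enorm_fderiv_mollify_le {G : EuclideanSpace ℝ (Fin N) → EuclideanSpace ℝ (Fin N)}
    {Ω : Set (EuclideanSpace ℝ (Fin N))} (hΩ : MeasurableSet Ω)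
    (φ : ContDiffBump (0 : EuclideanSpace ℝ (Fin N))) (hf : LocallyIntegrable (Ω.indicator f))
    (hGi : LocallyIntegrable (Ω.indicator G))
    (hG : HasWeakGradient Ω f G) {x : EuclideanSpace ℝ (Fin N)}
    (hx : Metric.closedBall x φ.rOut ⊆ Ω) :
    ‖fderiv ℝ (mollify φ (Ω.indicator f)) x‖ₑ ≤
      ∫⁻ y, ‖φ.normed volume y‖ₑ * ‖Ω.indicator G (x - y)‖ₑ := by
  have hint : Integrable fun y => φ.normed volume y • Ω.indicator G (x - y) :=
    φ.hasCompactSupport_normed.convolutionExists_left (ContinuousLinearMap.lsmul ℝ ℝ)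
      φ.continuous_normed hGi x
  set W := ∫ y, φ.normed volume y • Ω.indicator G (x - y) with hW
  have hWi : ∀ i, fderiv ℝ (mollify φ (Ω.indicator f)) x (EuclideanSpace.single i 1) = W i := by
    intro i
    rw [fderiv_mollify_single hΩ φ hf hG hx i]
    have := (EuclideanSpace.proj (𝕜 := ℝ) i : EuclideanSpace ℝ (Fin N) →L[ℝ] ℝ).integral_comp_comm
      hint
    simpa using this
  have heq : fderiv ℝ (mollify φ (Ω.indicator f)) x = innerSL ℝ W := by
    refine ContinuousLinearMap.coe_injective ?_
    refine (EuclideanSpace.basisFun (Fin N) ℝ).toBasis.ext fun i => ?_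
    simp only [OrthonormalBasis.coe_toBasis, EuclideanSpace.basisFun_apply]
    refine (hWi i).trans ?_
    simp [EuclideanSpace.inner_single_right]
  have hn : ‖fderiv ℝ (mollify φ (Ω.indicator f)) x‖ₑ = ‖W‖ₑ := by
    rw [heq, ← ofReal_norm, innerSL_apply_norm, ofReal_norm]
  rw [hn]
  refine (enorm_integral_le_lintegral_enorm _).trans_eq ?_
  simp [enorm_smul]

end Mollify

theorem locallyIntegrable_indicator {N : ℕ} {F : Type*} [NormedAddCommGroup F]
    {f : EuclideanSpace ℝ (Fin N) → F} {Ω : Set (EuclideanSpace ℝ (Fin N))}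
    (hΩ : MeasurableSet Ω) {p : ℝ≥0∞} (hp : 1 ≤ p) (hf : MemLp f p (volume.restrict Ω)) :
    LocallyIntegrable (Ω.indicator f) :=
  ((memLp_indicator_iff_restrict hΩ).2 hf).locallyIntegrable hp

/-- Approximation of Sobolev functions by smooth functions, up to a shrinking collar. -/
theorem exists_contDiff_approx {N : ℕ} {p : ℝ≥0∞} (hp1 : 1 ≤ p) {q : ℝ} (hq : 1 ≤ q)
    {u : EuclideanSpace ℝ (Fin N) → ℝ}
    {G : EuclideanSpace ℝ (Fin N) → EuclideanSpace ℝ (Fin N)} (hum : Measurable u)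
    (hGm : Measurable G) (hu : MemLp u p (volume.restrict (exterior N)))
    (hG : MemLp G p (volume.restrict (exterior N))) (hw : HasWeakGradient (exterior N) u G) :
    ∃ V : ℕ → EuclideanSpace ℝ (Fin N) → ℝ, (∀ n, ContDiff ℝ 1 (V n)) ∧
      (∀ᵐ x, x ∈ exterior N → Tendsto (fun n => V n x) atTop (𝓝 (u x))) ∧
      (∀ n, ∫⁻ x, ‖V n x‖ₑ ^ q ≤ ∫⁻ x in exterior N, ‖u x‖ₑ ^ q) ∧
      ∀ n : ℕ, ∫⁻ x in {x | 1 + 1 / ((n : ℝ) + 1) < ‖x‖}, ‖fderiv ℝ (V n) x‖ₑ ^ q ≤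
        ∫⁻ x in exterior N, ‖G x‖ₑ ^ q := by
  have hΩ : MeasurableSet (exterior N) := (isOpen_exterior N).measurableSet
  have hui := locallyIntegrable_indicator hΩ hp1 hu
  have hGi := locallyIntegrable_indicator hΩ hp1 hG
  have hq0 : 0 < q := by positivity
  have hpos : ∀ n : ℕ, (0 : ℝ) < 1 / ((n : ℝ) + 1) := fun n => Nat.one_div_pos_of_nat
  -- The outer radius is the width of the collar in the last claim; the inner radius is half of it,
  -- because Lebesgue differentiation needs a bounded ratio of the radii (here `K = 2`).
  let φ : ℕ → ContDiffBump (0 : EuclideanSpace ℝ (Fin N)) := fun n =>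
    ⟨1 / ((n : ℝ) + 1) / 2, 1 / ((n : ℝ) + 1), half_pos (hpos n), half_lt_self (hpos n)⟩
  have hm : ∀ n, Measurable fun y => ‖(φ n).normed volume y‖ₑ := fun n =>
    (φ n).continuous_normed.enorm.measurable
  refine ⟨fun n => mollify (φ n) ((exterior N).indicator u), fun n => contDiff_mollify _ hui,
    ?_, fun n => ?_, fun n => ?_⟩
  · have h := ContDiffBump.ae_convolution_tendsto_right_of_locallyIntegrable (φ := φ) (K := 2)
      (l := atTop) tendsto_one_div_add_atTop_nhds_zero_nat
      (Eventually.of_forall fun n => by simp only [φ]; linarith) hui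
    filter_upwards [h] with x hx hxΩ
    simpa only [mollify_eq_convolution, indicator_of_mem hxΩ] using hx
  · have h := lintegral_rpow_convolution_le volume (hm n) (lintegral_normed (φ n))
      (hum.indicator hΩ).enorm hq
    refine (lintegral_mono fun x => ENNReal.rpow_le_rpow (enorm_mollify_le _ _ x) hq0.le).trans
      (h.trans_eq ?_)
    rw [← lintegral_indicator hΩ]
    refine lintegral_congr fun x => ?_
    by_cases hx : x ∈ exterior N <;> simp [hx, hq0]
  · have h := lintegral_rpow_convolution_le volume (hm n) (lintegral_normed (φ n))
      (hGm.indicator hΩ).enorm hq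
    have hS : MeasurableSet {x : EuclideanSpace ℝ (Fin N) | 1 + 1 / ((n : ℝ) + 1) < ‖x‖} :=
      measurableSet_lt measurable_const measurable_norm
    refine (setLIntegral_mono' hS fun x hx => ENNReal.rpow_le_rpow
      (enorm_fderiv_mollify_le hΩ (φ n) hui hGi hw ?_) hq0.le).trans
      ((setLIntegral_le_lintegral _ _).trans (h.trans_eq ?_))
    · intro y hy
      rw [Metric.mem_closedBall, dist_comm, dist_eq_norm] at hy
      have h1 : ‖x‖ ≤ ‖x - y‖ + ‖y‖ := by simpa using norm_add_le (x - y) y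
      have h2 : ‖x - y‖ ≤ 1 / ((n : ℝ) + 1) := hy
      have h3 : 1 + 1 / ((n : ℝ) + 1) < ‖x‖ := hx
      rw [mem_exterior]
      linarith
    rw [← lintegral_indicator hΩ]
    refine lintegral_congr fun x => ?_
    by_cases hx : x ∈ exterior N <;> simp [hx, hq0]

/-- Fatou's lemma, in the form that transfers a uniform bound from the smooth approximants to the
limit. -/
theorem lintegral_le_of_tendsto_ae {α : Type*} [MeasurableSpace α] {ν : Measure α}
    {F : ℕ → α → ℝ≥0∞} {f : α → ℝ≥0∞} {C : ℝ≥0∞} (hF : ∀ n, Measurable (F n))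
    (hf : ∀ᵐ x ∂ν, Tendsto (fun n => F n x) atTop (𝓝 (f x)))
    (hC : ∀ᶠ n in atTop, ∫⁻ x, F n x ∂ν ≤ C) : ∫⁻ x, f x ∂ν ≤ C :=
  calc ∫⁻ x, f x ∂ν = ∫⁻ x, liminf (fun n => F n x) atTop ∂ν :=
        lintegral_congr_ae (hf.mono fun _ hx => hx.liminf_eq.symm)
    _ ≤ liminf (fun n => ∫⁻ x, F n x ∂ν) atTop := lintegral_liminf_le hF
    _ ≤ C := by
        refine (liminf_le_liminf hC).trans_eq ?_
        simp

/-! ### The weighted, translation and averaging estimates for Sobolev functions -/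

section Sobolev

variable {N : ℕ} {p : ℝ≥0∞} {q : ℝ} {u : EuclideanSpace ℝ (Fin N) → ℝ}
  {G : EuclideanSpace ℝ (Fin N) → EuclideanSpace ℝ (Fin N)}

/-- A radial weight of finite mass embeds the Sobolev space into the weighted `L^q` space. -/
theorem lintegral_radial_weight_le (hN : 1 ≤ N) (hp1 : 1 ≤ p) (hq : 1 ≤ q) (hum : Measurable u)
    (hGm : Measurable G) (hu : MemLp u p (volume.restrict (exterior N)))
    (hG : MemLp G p (volume.restrict (exterior N))) (hw : HasWeakGradient (exterior N) u G)
    {γ : ℝ → ℝ≥0∞} (hγ : Measurable γ) :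
    ∫⁻ x in exterior N, γ ‖x‖ * ‖u x‖ₑ ^ q ≤ 2 ^ (q - 1) * (∫⁻ r in Ioi 1, γ r) *
      ((∫⁻ x in exterior N, ‖u x‖ₑ ^ q) + ∫⁻ x in exterior N, ‖G x‖ₑ ^ q) := by
  have : Nonempty (Fin N) := ⟨⟨0, hN⟩⟩
  have hΩ : MeasurableSet (exterior N) := (isOpen_exterior N).measurableSet
  obtain ⟨V, hV, hlim, hVu, hVG⟩ := exists_contDiff_approx hp1 hq hum hGm hu hG hw
  have hγn : Measurable fun x : EuclideanSpace ℝ (Fin N) => γ ‖x‖ := hγ.comp measurable_norm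
  have huq : Measurable fun x => ‖u x‖ₑ ^ q := hum.enorm.pow_const q
  let S : ℕ → Set (EuclideanSpace ℝ (Fin N)) := fun n => {x | 1 + 1 / ((n : ℝ) + 1) < ‖x‖}
  have hS : ∀ n, MeasurableSet (S n) := fun n => measurableSet_lt measurable_const measurable_norm
  have hVq : ∀ n, Measurable fun x => ‖V n x‖ₑ ^ q := fun n =>
    (hV n).continuous.enorm.measurable.pow_const q
  set ν := (volume.restrict (exterior N)).withDensity fun x => γ ‖x‖ with hν
  have key : ∫⁻ x, ‖u x‖ₑ ^ q ∂ν ≤ 2 ^ (q - 1) * (∫⁻ r in Ioi 1, γ r) *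
      ((∫⁻ x in exterior N, ‖u x‖ₑ ^ q) + ∫⁻ x in exterior N, ‖G x‖ₑ ^ q) := by
    -- The gradient of `V n` is controlled only off the collar, hence the cut-off to `S n`; every
    -- point of the exterior lies in `S n` for large `n`, so the limit is unaffected.
    refine lintegral_le_of_tendsto_ae (F := fun n => (S n).indicator fun x => ‖V n x‖ₑ ^ q)
      (fun n => (hVq n).indicator (hS n)) ?_ (Eventually.of_forall fun n => ?_)
    · refine withDensity_absolutelyContinuous _ _ ?_
      filter_upwards [ae_restrict_of_ae hlim, ae_restrict_mem hΩ] with x hx hxΩ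
      have h1 := ((ENNReal.continuous_rpow_const (y := q)).tendsto _).comp
        ((continuous_enorm.tendsto _).comp (hx hxΩ))
      refine h1.congr' ?_
      have h2 : Tendsto (fun n : ℕ => 1 + 1 / ((n : ℝ) + 1)) atTop (𝓝 (1 + 0)) :=
        tendsto_one_div_add_atTop_nhds_zero_nat.const_add 1
      rw [add_zero] at h2
      filter_upwards [h2.eventually (gt_mem_nhds (mem_exterior.1 hxΩ))] with n hn
      simp only [Function.comp_apply]
      rw [indicator_of_mem (show x ∈ S n from hn)]
    · rw [hν, lintegral_withDensity_eq_lintegral_mul _ hγn ((hVq n).indicator (hS n))]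
      calc ∫⁻ x in exterior N, γ ‖x‖ * (S n).indicator (fun x => ‖V n x‖ₑ ^ q) x
          ≤ ∫⁻ x, (S n).indicator (fun x => γ ‖x‖ * ‖V n x‖ₑ ^ q) x := by
            refine (setLIntegral_le_lintegral _ _).trans (lintegral_mono fun x => ?_)
            by_cases hx : x ∈ S n <;> simp [hx]
        _ ≤ 2 ^ (q - 1) * (∫⁻ r in Ioi (1 + 1 / ((n : ℝ) + 1)), γ r) *
            ∫⁻ x in S n, (‖V n x‖ₑ ^ q + ‖fderiv ℝ (V n) x‖ₑ ^ q) := by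
            rw [lintegral_indicator (hS n)]
            exact lintegral_radial_weight_le_of_contDiff volume (hV n) hq hγ _
        _ ≤ _ := by
            rw [lintegral_add_left (hVq n)]
            have h2 : (0 : ℝ) < 1 / ((n : ℝ) + 1) := Nat.one_div_pos_of_nat
            refine mul_le_mul' (mul_le_mul' le_rfl (lintegral_mono_set ?_))
              (add_le_add ((setLIntegral_le_lintegral _ _).trans (hVu n)) (hVG n))
            exact Ioi_subset_Ioi (by linarith)
  rwa [hν, lintegral_withDensity_eq_lintegral_mul _ hγn huq] at key

theorem lintegral_sub_translate_le (hp1 : 1 ≤ p) (hq : 1 ≤ q) (hum : Measurable u)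
    (hGm : Measurable G) (hu : MemLp u p (volume.restrict (exterior N)))
    (hG : MemLp G p (volume.restrict (exterior N))) (hw : HasWeakGradient (exterior N) u G)
    {A : Set (EuclideanSpace ℝ (Fin N))} (hA : MeasurableSet A) {δ : ℝ} (hδ : 0 < δ)
    (hAδ : ∀ x ∈ A, 1 + δ ≤ ‖x‖) {z : EuclideanSpace ℝ (Fin N)} (hz : ‖z‖ ≤ δ / 2) :
    ∫⁻ x in A, ‖u x - u (x - z)‖ₑ ^ q ≤ ‖z‖ₑ ^ q * ∫⁻ x in exterior N, ‖G x‖ₑ ^ q := by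
  obtain ⟨V, hV, hlim, hVu, hVG⟩ := exists_contDiff_approx hp1 hq hum hGm hu hG hw
  have hlim' : ∀ᵐ x, x - z ∈ exterior N →
      Tendsto (fun n => V n (x - z)) atTop (𝓝 (u (x - z))) :=
    (measurePreserving_sub_right volume z).quasiMeasurePreserving.ae hlim
  have hfar : ∀ x ∈ A, ∀ t ∈ Icc (0 : ℝ) 1, 1 + δ / 2 ≤ ‖x - t • z‖ := by
    intro x hx t ht
    have h1 : ‖x‖ ≤ ‖x - t • z‖ + ‖t • z‖ := by simpa using norm_add_le (x - t • z) (t • z)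
    have h2 : ‖t • z‖ ≤ ‖z‖ := by
      rw [norm_smul, Real.norm_of_nonneg ht.1]
      exact mul_le_of_le_one_left (norm_nonneg z) ht.2
    linarith [hAδ x hx]
  refine lintegral_le_of_tendsto_ae (F := fun n x => ‖V n x - V n (x - z)‖ₑ ^ q)
    (fun n => ?_) ?_ ?_
  · have h1 := (hV n).continuous
    exact (h1.sub (h1.comp (by fun_prop))).enorm.measurable.pow_const q
  · filter_upwards [ae_restrict_of_ae hlim, ae_restrict_of_ae hlim', ae_restrict_mem hA]
      with x hx hx' hxA
    have e0 : x ∈ exterior N := mem_exterior.2 (by linarith [hAδ x hxA])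
    have e1 : x - z ∈ exterior N := mem_exterior.2 (by
      have := hfar x hxA 1 ⟨zero_le_one, le_rfl⟩
      rw [one_smul] at this
      linarith)
    exact ((ENNReal.continuous_rpow_const (y := q)).tendsto _).comp
        ((continuous_enorm.tendsto _).comp ((hx e0).sub (hx' e1)))
  -- Since `‖z‖ ≤ δ / 2`, the segments keep distance at least `δ / 2` from the unit ball; once the
  -- collar is thinner than that, the gradient bound applies along them.
  · filter_upwards [tendsto_one_div_add_atTop_nhds_zero_nat.eventually
      (gt_mem_nhds (half_pos hδ))] with n hn
    refine (lintegral_sub_translate_le_of_contDiff volume (hV n) hq hA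
      (measurableSet_lt measurable_const measurable_norm :
        MeasurableSet {x : EuclideanSpace ℝ (Fin N) | 1 + 1 / ((n : ℝ) + 1) < ‖x‖}) ?_).trans ?_
    · intro x hx t ht
      exact lt_of_lt_of_le (by linarith) (hfar x hx t ht)
    · exact mul_le_mul' le_rfl (hVG n)

/-- Averages over nearby small balls approximate a Sobolev function. -/
theorem lintegral_sub_average_le (hN : 1 ≤ N) (hp1 : 1 ≤ p) (hq : 1 ≤ q) (hum : Measurable u)
    (hGm : Measurable G) (hu : MemLp u p (volume.restrict (exterior N)))
    (hG : MemLp G p (volume.restrict (exterior N))) (hw : HasWeakGradient (exterior N) u G)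
    {A : Set (EuclideanSpace ℝ (Fin N))} (hA : MeasurableSet A) {h : ℝ} (hh : 0 < h)
    (hAδ : ∀ x ∈ A, 1 + 4 * h ≤ ‖x‖) {c : EuclideanSpace ℝ (Fin N) → EuclideanSpace ℝ (Fin N)}
    (hc : ∀ x ∈ A, ‖x - c x‖ < h) :
    ∫⁻ x in A, ‖u x - ⨍ t in Metric.ball (c x) h, u t‖ₑ ^ q ≤
      2 ^ N * ENNReal.ofReal (2 * h) ^ q * ∫⁻ x in exterior N, ‖G x‖ₑ ^ q := by
  have : Nonempty (Fin N) := ⟨⟨0, hN⟩⟩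
  set b := volume (Metric.ball (0 : EuclideanSpace ℝ (Fin N)) h) with hb
  have hb0 : b ≠ 0 := (Metric.measure_ball_pos volume _ hh).ne'
  have hbt : b ≠ ⊤ := measure_ball_lt_top.ne
  have hbc : ∀ y : EuclideanSpace ℝ (Fin N), volume (Metric.ball y h) = b := fun y =>
    Measure.addHaar_ball_center volume y h
  have hb2 : volume (Metric.ball (0 : EuclideanSpace ℝ (Fin N)) (2 * h)) = 2 ^ N * b := by
    rw [Measure.addHaar_ball_mul volume _ (by norm_num : (0 : ℝ) ≤ 2)]
    simp [hb, ENNReal.ofReal_pow]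
  -- After Jensen, enlarging the ball about `c x` to the ball of radius `2 * h` about `x` removes
  -- the dependence on `c`, and `t = x - z` turns the bound into translates.
  have hpt : ∀ x ∈ A, ‖u x - ⨍ t in Metric.ball (c x) h, u t‖ₑ ^ q ≤
      b⁻¹ * ∫⁻ z in Metric.ball 0 (2 * h), ‖u x - u (x - z)‖ₑ ^ q := by
    intro x hx
    have hsub : Metric.ball (c x) h ⊆ exterior N := by
      intro t ht
      rw [mem_ball_iff_norm] at ht
      have h1 : ‖x‖ ≤ ‖x - c x‖ + (‖c x - t‖ + ‖t‖) := by
        calc ‖x‖ = ‖(x - c x) + ((c x - t) + t)‖ := by congr 1; abel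
          _ ≤ _ := (norm_add_le _ _).trans (by gcongr; exact norm_add_le _ _)
      rw [norm_sub_rev] at ht
      rw [mem_exterior]
      linarith [hAδ x hx, hc x hx]
    have hfin : IsFiniteMeasure (volume.restrict (Metric.ball (c x) h)) :=
      ⟨by rw [Measure.restrict_apply_univ, hbc]; exact hbt.lt_top⟩
    have hui : Integrable u (volume.restrict (Metric.ball (c x) h)) :=
      (hu.mono_measure (Measure.restrict_mono hsub le_rfl)).integrable hp1
    set κ := (volume (Metric.ball (c x) h))⁻¹ • volume.restrict (Metric.ball (c x) h) with hκ
    have hκp : IsProbabilityMeasure κ := ⟨by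
      rw [hκ, Measure.smul_apply, Measure.restrict_apply_univ, hbc, smul_eq_mul,
        ENNReal.inv_mul_cancel hb0 hbt]⟩
    have huκ : Integrable u κ := hui.smul_measure (by simp [hbc, hb0])
    have havg : ⨍ t in Metric.ball (c x) h, u t = ∫ t, u t ∂κ := by
      rw [average, Measure.restrict_apply_univ]
    have hdiff : u x - ⨍ t in Metric.ball (c x) h, u t = ∫ t, (u x - u t) ∂κ := by
      rw [havg, integral_sub (integrable_const _) huκ, integral_const]
      simp
    rw [hdiff]
    have hmx : Measurable fun t => ‖u x - u t‖ₑ := (measurable_const.sub hum).enorm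
    calc ‖∫ t, (u x - u t) ∂κ‖ₑ ^ q ≤ (∫⁻ t, ‖u x - u t‖ₑ ∂κ) ^ q := by
          gcongr; exact enorm_integral_le_lintegral_enorm _
      _ ≤ ∫⁻ t, ‖u x - u t‖ₑ ^ q ∂κ := rpow_lintegral_le κ hmx.aemeasurable hq
      _ = b⁻¹ * ∫⁻ t in Metric.ball (c x) h, ‖u x - u t‖ₑ ^ q := by
          rw [hκ, lintegral_smul_measure, hbc, smul_eq_mul]
      _ ≤ b⁻¹ * ∫⁻ t in Metric.ball x (2 * h), ‖u x - u t‖ₑ ^ q := by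
          gcongr
          refine Metric.ball_subset_ball' ?_
          rw [dist_eq_norm, norm_sub_rev]
          linarith [hc x hx]
      _ = _ := by
          congr 1
          rw [← lintegral_indicator measurableSet_ball, ← lintegral_indicator measurableSet_ball,
            ← lintegral_sub_left_eq_self _ x]
          refine lintegral_congr fun z => ?_
          by_cases hz : ‖z‖ < 2 * h
          · rw [indicator_of_mem (by simpa using hz), indicator_of_mem (by simpa using hz)]
          · rw [indicator_of_notMem (by simpa using hz), indicator_of_notMem (by simpa using hz)]
  have hjm : Measurable fun y : EuclideanSpace ℝ (Fin N) × EuclideanSpace ℝ (Fin N) =>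
      ‖u y.1 - u (y.1 - y.2)‖ₑ ^ q :=
    ((hum.comp measurable_fst).sub
      (hum.comp (measurable_fst.sub measurable_snd))).enorm.pow_const q
  set I := ∫⁻ x in exterior N, ‖G x‖ₑ ^ q
  calc ∫⁻ x in A, ‖u x - ⨍ t in Metric.ball (c x) h, u t‖ₑ ^ q
      ≤ ∫⁻ x in A, b⁻¹ * ∫⁻ z in Metric.ball 0 (2 * h), ‖u x - u (x - z)‖ₑ ^ q :=
        setLIntegral_mono' hA hpt
    _ = b⁻¹ * ∫⁻ z in Metric.ball 0 (2 * h), ∫⁻ x in A, ‖u x - u (x - z)‖ₑ ^ q := by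
        rw [lintegral_const_mul' _ _ (ENNReal.inv_ne_top.2 hb0),
          lintegral_lintegral_swap hjm.aemeasurable]
    _ ≤ b⁻¹ * ∫⁻ z in Metric.ball (0 : EuclideanSpace ℝ (Fin N)) (2 * h),
          ENNReal.ofReal (2 * h) ^ q * I := by
        gcongr b⁻¹ * ?_
        refine setLIntegral_mono' measurableSet_ball fun z hz => ?_
        rw [mem_ball_zero_iff] at hz
        -- Here `δ = 4 * h`, so `δ / 2 = 2 * h` is exactly the radius of the ball of shifts.
        refine (lintegral_sub_translate_le hp1 hq hum hGm hu hG hw hA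
          (by positivity : 0 < 4 * h) hAδ (by linarith)).trans ?_
        gcongr
        rw [← ofReal_norm]
        exact ENNReal.ofReal_le_ofReal hz.le
    _ = _ := by
        rw [setLIntegral_const, hb2]
        calc b⁻¹ * (ENNReal.ofReal (2 * h) ^ q * I * (2 ^ N * b))
            = (b⁻¹ * b) * (2 ^ N * ENNReal.ofReal (2 * h) ^ q * I) := by ring
          _ = _ := by rw [ENNReal.inv_mul_cancel hb0 hbt, one_mul]

end Sobolev

/-! ### Null sets on spheres and the radial majorant of the weight -/

theorem measure_polar {E : Type*} [NormedAddCommGroup E] [NormedSpace ℝ E]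
    [FiniteDimensional ℝ E] [MeasurableSpace E] [BorelSpace E] [Nontrivial E]
    (μ : Measure E) [μ.IsAddHaarMeasure] {S : Set E} (hS : MeasurableSet S) :
    μ S = ∫⁻ r in Ioi (0 : ℝ), ENNReal.ofReal (r ^ (Module.finrank ℝ E - 1)) *
      μ.toSphere {θ | r • (θ : E) ∈ S} := by
  have hm : Measurable fun z : Metric.sphere (0 : E) 1 × ℝ =>
      ENNReal.ofReal (z.2 ^ (Module.finrank ℝ E - 1)) * S.indicator 1 (z.2 • (z.1 : E)) :=
    (by fun_prop : Measurable fun z : Metric.sphere (0 : E) 1 × ℝ =>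
      ENNReal.ofReal (z.2 ^ (Module.finrank ℝ E - 1))).mul
      ((measurable_one.indicator hS).comp (by fun_prop))
  rw [← lintegral_indicator_one hS, lintegral_polar μ (measurable_one.indicator hS),
    lintegral_lintegral_swap hm.aemeasurable]
  refine lintegral_congr fun r => ?_
  have hSr : MeasurableSet {θ : Metric.sphere (0 : E) 1 | r • (θ : E) ∈ S} :=
    (by fun_prop : Measurable fun θ : Metric.sphere (0 : E) 1 => r • (θ : E)) hS
  have hmr : Measurable fun θ : Metric.sphere (0 : E) 1 =>
      S.indicator (1 : E → ℝ≥0∞) (r • (θ : E)) :=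
    (measurable_one.indicator hS).comp (by fun_prop)
  rw [lintegral_const_mul _ hmr, ← lintegral_indicator_one hSr]
  rfl

theorem measurable_toSphere_section {E : Type*} [NormedAddCommGroup E] [NormedSpace ℝ E]
    [FiniteDimensional ℝ E] [MeasurableSpace E] [BorelSpace E]
    (μ : Measure E) [μ.IsAddHaarMeasure] {S : Set E} (hS : MeasurableSet S) :
    Measurable fun r : ℝ => μ.toSphere {θ | r • (θ : E) ∈ S} :=
  measurable_measure_prodMk_left
    (ν := μ.toSphere) (s := {z : ℝ × Metric.sphere (0 : E) 1 | z.1 • (z.2 : E) ∈ S})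
    ((by fun_prop : Measurable fun z : ℝ × Metric.sphere (0 : E) 1 => z.1 • (z.2 : E)) hS)

/-- A null set has null sections on almost every sphere, because the Jacobian in polar coordinates
is positive. This lets `g` be replaced by a measurable representative inside the spherical essential
supremum. -/
theorem ae_ae_smul_of_ae {E : Type*} [NormedAddCommGroup E] [NormedSpace ℝ E]
    [FiniteDimensional ℝ E] [MeasurableSpace E] [BorelSpace E] [Nontrivial E]
    (μ : Measure E) [μ.IsAddHaarMeasure] {P : E → Prop} (hP : ∀ᵐ x ∂μ, P x) :
    ∀ᵐ r ∂(volume.restrict (Ioi (0 : ℝ))),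
      ∀ᵐ θ : Metric.sphere (0 : E) 1 ∂μ.toSphere, P (r • (θ : E)) := by
  obtain ⟨S, hPS, hS, hS0⟩ := exists_measurable_superset_of_null (ae_iff.1 hP)
  rw [measure_polar μ hS] at hS0
  have hm : Measurable fun r : ℝ => ENNReal.ofReal (r ^ (Module.finrank ℝ E - 1)) *
      μ.toSphere {θ | r • (θ : E) ∈ S} :=
    (by fun_prop : Measurable fun r : ℝ => ENNReal.ofReal (r ^ (Module.finrank ℝ E - 1))).mul
      (measurable_toSphere_section μ hS)
  rw [lintegral_eq_zero_iff hm] at hS0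
  filter_upwards [hS0, ae_restrict_mem measurableSet_Ioi] with r hr hr0
  have hr0' : (0 : ℝ) < r := hr0
  have h1 : ENNReal.ofReal (r ^ (Module.finrank ℝ E - 1)) ≠ 0 := by
    simpa using pow_pos hr0' _
  have h2 : μ.toSphere {θ | r • (θ : E) ∈ S} = 0 := (mul_eq_zero.1 hr).resolve_left h1
  exact measure_mono_null (fun θ hθ => hPS hθ) h2

/-- In both cases the base is at least `1` and the exponent is nonnegative. It follows that `X`
embeds in the unweighted `L¹(1, ∞)`. -/
theorem one_le_radialWeight {N : ℕ} (hN : 1 ≤ N) {p : ℝ≥0∞} (hp1 : 1 ≤ p) (hp : p ≠ ⊤) {r : ℝ}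
    (hr : 1 < r) : 1 ≤ radialWeight N p r := by
  have hp' : 1 ≤ p.toReal := by simpa using ENNReal.toReal_mono hp hp1
  have hN' : (1 : ℝ) ≤ N := by exact_mod_cast hN
  unfold radialWeight
  split_ifs
  · refine Real.one_le_rpow ?_ (by linarith)
    nlinarith [Real.log_nonneg hr.le]
  · exact Real.one_le_rpow hr.le (by linarith)

theorem MemX.memLp_one {N : ℕ} (hN : 1 ≤ N) {p : ℝ≥0∞} (hp1 : 1 ≤ p) (hp : p ≠ ⊤) {f : ℝ → ℝ≥0∞}
    (hf : MemX N p f) : MemLp f 1 (volume.restrict (Ioi (1 : ℝ))) := by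
  refine MemLp.mono_measure ?_ hf
  conv_lhs => rw [← withDensity_one (μ := volume.restrict (Ioi (1 : ℝ)))]
  refine withDensity_mono ?_
  filter_upwards [ae_restrict_mem measurableSet_Ioi] with r hr
  simpa using one_le_radialWeight hN hp1 hp hr

/-- A weight whose envelope belongs to `X` is dominated by an integrable radial function. -/
theorem exists_radial_majorant {N : ℕ} (hN : 1 ≤ N) {p : ℝ≥0∞} (hp1 : 1 ≤ p) (hp : p ≠ ⊤)
    {g : EuclideanSpace ℝ (Fin N) → ℝ} (hg : LocallyIntegrableOn g (exterior N))
    (hgX : MemX N p (radialEnvelope g)) :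
    ∃ γ : ℝ → ℝ≥0∞, Measurable γ ∧ ∫⁻ r in Ioi 1, γ r ≠ ⊤ ∧
      ∀ᵐ x, x ∈ exterior N → ‖g x‖ₑ ≤ γ ‖x‖ := by
  have : Nonempty (Fin N) := ⟨⟨0, hN⟩⟩
  have hΩ : MeasurableSet (exterior N) := (isOpen_exterior N).measurableSet
  have hX := hgX.memLp_one hN hp1 hp
  have hXm : AEMeasurable (radialEnvelope g) (volume.restrict (Ioi (1 : ℝ))) :=
    hX.1.aemeasurable
  refine ⟨hXm.mk _, hXm.measurable_mk, ?_, ?_⟩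
  · rw [← lintegral_congr_ae hXm.ae_eq_mk]
    have := hX.2
    rw [eLpNorm_one_eq_lintegral_enorm] at this
    simpa using this.ne
  have hgm := hg.aestronglyMeasurable
  set g' := hgm.mk g with hg'
  have hgg : ∀ᵐ x, x ∈ exterior N → g x = g' x := (ae_restrict_iff' hΩ).1 hgm.ae_eq_mk
  -- The points where the majorant fails. For almost every radius the section of `S` is null by
  -- definition of the essential supremum, so `S` is null by polar coordinates.
  set S : Set (EuclideanSpace ℝ (Fin N)) := {x | 1 < ‖x‖ ∧ hXm.mk (radialEnvelope g) ‖x‖ < ‖g' x‖ₑ} with hSdef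
  have hS : MeasurableSet S :=
    (measurableSet_lt measurable_const measurable_norm).inter
      (measurableSet_lt (hXm.measurable_mk.comp measurable_norm)
        hgm.stronglyMeasurable_mk.measurable.enorm)
  have hS0 : volume S = 0 := by
    rw [measure_polar volume hS]
    refine (lintegral_eq_zero_iff' ?_).2 ?_ |>.trans rfl
    · refine (Measurable.mul (by fun_prop) ?_).aemeasurable
      exact measurable_toSphere_section volume hS
    · have h1 : ∀ᵐ r ∂(volume.restrict (Ioi (0 : ℝ))), r ∈ Ioi (1 : ℝ) →
          radialEnvelope g r = hXm.mk (radialEnvelope g) r :=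
        ae_restrict_of_ae ((ae_restrict_iff' measurableSet_Ioi).1 hXm.ae_eq_mk)
      filter_upwards [ae_ae_smul_of_ae volume hgg, h1, ae_restrict_mem measurableSet_Ioi]
        with r hr hr1 hr0
      have hn : ∀ θ : Metric.sphere (0 : EuclideanSpace ℝ (Fin N)) 1,
          ‖r • (θ : EuclideanSpace ℝ (Fin N))‖ = r := fun θ => by
        rw [norm_smul, Real.norm_of_nonneg (le_of_lt hr0)]
        simp
      have h2 : (volume : Measure (EuclideanSpace ℝ (Fin N))).toSphere
          {θ | r • (θ : EuclideanSpace ℝ (Fin N)) ∈ S} = 0 := by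
        refine measure_mono_null ?_ (ae_iff.1 (hr.and (ENNReal.ae_le_essSup
          (μ := (volume : Measure (EuclideanSpace ℝ (Fin N))).toSphere)
          fun θ : Metric.sphere (0 : EuclideanSpace ℝ (Fin N)) 1 =>
            ‖g (r • (θ : EuclideanSpace ℝ (Fin N)))‖ₑ)))
        rintro θ ⟨hθ1, hθ2⟩ ⟨h3, h4⟩
        rw [hn] at hθ1 hθ2
        rw [← h3 (mem_exterior.2 (by rwa [hn])), ← hr1 hθ1] at hθ2
        exact absurd h4 (not_le.2 hθ2)
      simp [h2]
  filter_upwards [hgg, measure_eq_zero_iff_ae_notMem.1 hS0] with x hx hxS hxΩ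
  rw [hx hxΩ]
  exact not_lt.1 fun h => hxS ⟨mem_exterior.1 hxΩ, h⟩

/-! ### From integral inequalities to bounded and compact operators -/

theorem lintegral_rpow_enorm_Lp {α F : Type*} [MeasurableSpace α] {μ : Measure α}
    [NormedAddCommGroup F] {p : ℝ≥0∞} [Fact (1 ≤ p)] (hp : p ≠ ⊤) (f : Lp F p μ) :
    ∫⁻ x, ‖f x‖ₑ ^ p.toReal ∂μ = ‖f‖ₑ ^ p.toReal := by
  have h1 : (1 : ℝ≥0∞) ≤ p := Fact.out
  have h0 : p ≠ 0 := (zero_lt_one.trans_le h1).ne'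
  rw [Lp.enorm_def, eLpNorm_eq_lintegral_rpow_enorm_toReal h0 hp, ← ENNReal.rpow_mul,
    one_div_mul_cancel (ENNReal.toReal_pos h0 hp).ne', ENNReal.rpow_one]

theorem norm_le_of_enorm_rpow_le {F F' : Type*} [SeminormedAddCommGroup F]
    [SeminormedAddCommGroup F'] {q : ℝ} (hq : 0 < q) {C : ℝ≥0∞} (hC : C ≠ ⊤) {a : F} {b : F'}
    (h : ‖a‖ₑ ^ q ≤ C * ‖b‖ₑ ^ q) : ‖a‖ ≤ (C ^ (1 / q)).toReal * ‖b‖ := by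
  have h1 : ‖a‖ₑ ≤ C ^ (1 / q) * ‖b‖ₑ := by
    have := ENNReal.rpow_le_rpow h (one_div_nonneg.2 hq.le)
    rwa [ENNReal.mul_rpow_of_nonneg _ _ (one_div_nonneg.2 hq.le), ← ENNReal.rpow_mul,
      ← ENNReal.rpow_mul, mul_one_div_cancel hq.ne', ENNReal.rpow_one, ENNReal.rpow_one] at this
  have h2 : C ^ (1 / q) ≠ ⊤ := ENNReal.rpow_ne_top_of_nonneg (one_div_nonneg.2 hq.le) hC
  have h3 := ENNReal.toReal_mono (ENNReal.mul_ne_top h2 enorm_ne_top) h1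
  simpa using h3

theorem exists_clm_of_enorm_rpow_le {F F' : Type*} [SeminormedAddCommGroup F] [NormedSpace ℝ F]
    [SeminormedAddCommGroup F'] [NormedSpace ℝ F'] {q : ℝ} (hq : 0 < q) {C : ℝ≥0∞} (hC : C ≠ ⊤)
    (f : F → F') (hadd : ∀ v w, f (v + w) = f v + f w) (hsmul : ∀ (c : ℝ) w, f (c • w) = c • f w)
    (h : ∀ w, ‖f w‖ₑ ^ q ≤ C * ‖w‖ₑ ^ q) : ∃ T : F →L[ℝ] F', ∀ w, T w = f w :=
  ⟨LinearMap.mkContinuous { toFun := f, map_add' := hadd, map_smul' := hsmul }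
    (C ^ (1 / q)).toReal fun w => norm_le_of_enorm_rpow_le hq hC (h w), fun _ => rfl⟩

section Generic

variable {F X : Type*} [SeminormedAddCommGroup F] [NormedSpace ℝ F] [MeasurableSpace X]
  {U : F → X → ℝ}

theorem exists_clm_Lp {μ : Measure X} {p : ℝ≥0∞} [Fact (1 ≤ p)] (hp : p ≠ ⊤) {C : ℝ≥0∞}
    (hC : C ≠ ⊤) (hmem : ∀ w, MemLp (U w) p μ)
    (hadd : ∀ v w, U (v + w) =ᵐ[μ] fun x => U v x + U w x)
    (hsmul : ∀ (c : ℝ) w, U (c • w) =ᵐ[μ] fun x => c * U w x)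
    (h : ∀ w, ∫⁻ x, ‖U w x‖ₑ ^ p.toReal ∂μ ≤ C * ‖w‖ₑ ^ p.toReal) :
    ∃ T : F →L[ℝ] Lp ℝ p μ, ∀ w, T w =ᵐ[μ] U w := by
  have hp1 : (1 : ℝ≥0∞) ≤ p := Fact.out
  have hq0 : 0 < p.toReal := ENNReal.toReal_pos (zero_lt_one.trans_le hp1).ne' hp
  obtain ⟨T, hT⟩ := exists_clm_of_enorm_rpow_le hq0 hC (fun w => (hmem w).toLp)
    (fun v w => by
      refine Lp.ext ?_
      filter_upwards [(hmem (v + w)).coeFn_toLp, (hmem v).coeFn_toLp, (hmem w).coeFn_toLp,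
        Lp.coeFn_add ((hmem v).toLp) ((hmem w).toLp), hadd v w] with x h1 h2 h3 h4 h5
      rw [h1, h4, h5, Pi.add_apply, h2, h3])
    (fun c w => by
      refine Lp.ext ?_
      filter_upwards [(hmem (c • w)).coeFn_toLp, (hmem w).coeFn_toLp,
        Lp.coeFn_smul c ((hmem w).toLp), hsmul c w] with x h1 h2 h3 h4
      rw [h1, h3, h4, Pi.smul_apply, h2, smul_eq_mul])
    (fun w => by
      rw [← lintegral_rpow_enorm_Lp hp]
      refine le_trans (lintegral_mono_ae ?_) (h w)
      filter_upwards [(hmem w).coeFn_toLp] with x hx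
      rw [hx])
  exact ⟨T, fun w => by rw [hT w]; exact (hmem w).coeFn_toLp⟩

theorem exists_clm_integral {κ : Measure X} [IsProbabilityMeasure κ] {q : ℝ} (hq : 1 ≤ q)
    {C : ℝ≥0∞} (hC : C ≠ ⊤) (hint : ∀ w, Integrable (U w) κ)
    (hadd : ∀ v w, U (v + w) =ᵐ[κ] fun x => U v x + U w x)
    (hsmul : ∀ (c : ℝ) w, U (c • w) =ᵐ[κ] fun x => c * U w x)
    (h : ∀ w, ∫⁻ x, ‖U w x‖ₑ ^ q ∂κ ≤ C * ‖w‖ₑ ^ q) :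
    ∃ ℓ : F →L[ℝ] ℝ, ∀ w, ℓ w = ∫ x, U w x ∂κ := by
  refine exists_clm_of_enorm_rpow_le (by positivity) hC (fun w => ∫ x, U w x ∂κ)
    (fun v w => ?_) (fun c w => ?_) (fun w => ?_)
  · rw [integral_congr_ae (hadd v w), integral_add (hint v) (hint w)]
  · rw [integral_congr_ae (hsmul c w), integral_const_mul, smul_eq_mul]
  · calc ‖∫ t, U w t ∂κ‖ₑ ^ q ≤ (∫⁻ t, ‖U w t‖ₑ ∂κ) ^ q := by
          gcongr; exact enorm_integral_le_lintegral_enorm _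
      _ ≤ ∫⁻ t, ‖U w t‖ₑ ^ q ∂κ := rpow_lintegral_le κ (hint w).1.aemeasurable.enorm hq
      _ ≤ _ := h w

end Generic

/-- A continuous linear map is compact if it can be approximated by compact ones. -/
theorem isCompactOperator_of_approx {F F' : Type*} [NormedAddCommGroup F] [NormedSpace ℝ F]
    [NormedAddCommGroup F'] [NormedSpace ℝ F'] [CompleteSpace F'] {q : ℝ} (hq : 0 < q)
    (T : F →L[ℝ] F')
    (h : ∀ c : ℝ≥0∞, 0 < c → c ≠ ⊤ → ∃ S : F →L[ℝ] F', IsCompactOperator S ∧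
      ∀ w, ‖T w - S w‖ₑ ^ q ≤ c * ‖w‖ₑ ^ q) : IsCompactOperator T := by
  have hcl : T ∈ closure {f : F →L[ℝ] F' | IsCompactOperator f} := by
    refine Metric.mem_closure_iff.2 fun ε hε => ?_
    have hc : ENNReal.ofReal (ε / 2) ^ q ≠ ⊤ :=
      ENNReal.rpow_ne_top_of_nonneg hq.le ENNReal.ofReal_ne_top
    -- With `c = (ε / 2) ^ q` the operator norm of `T - S` is at most `ε / 2`; the half leaves room
    -- for the strict inequality.
    obtain ⟨S, hS, hTS⟩ := h (ENNReal.ofReal (ε / 2) ^ q)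
      (ENNReal.rpow_pos (ENNReal.ofReal_pos.2 (half_pos hε)) ENNReal.ofReal_ne_top) hc
    refine ⟨S, hS, ?_⟩
    rw [dist_eq_norm]
    refine lt_of_le_of_lt (ContinuousLinearMap.opNorm_le_bound _ (half_pos hε).le fun w => ?_)
      (half_lt_self hε)
    have h1 := norm_le_of_enorm_rpow_le hq hc (hTS w)
    rwa [← ENNReal.rpow_mul, mul_one_div_cancel hq.ne', ENNReal.rpow_one,
      ENNReal.toReal_ofReal (half_pos hε).le] at h1
  rwa [isClosed_setOfPred_isCompactOperator.closure_eq] at hcl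

/-- A normed space `F` parametrizing functions `U w` in the Sobolev space of the exterior domain,
with weak gradients `G w`, in such a way that its norm is the Sobolev norm. -/
structure IsSobolevFamily {N : ℕ} (p : ℝ≥0∞) {F : Type*} [NormedAddCommGroup F]
    [NormedSpace ℝ F] (U : F → EuclideanSpace ℝ (Fin N) → ℝ)
    (G : F → EuclideanSpace ℝ (Fin N) → EuclideanSpace ℝ (Fin N)) : Prop where
  measurable_fun : ∀ w, Measurable (U w)
  measurable_grad : ∀ w, Measurable (G w)
  memLp_fun : ∀ w, MemLp (U w) p (volume.restrict (exterior N))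
  memLp_grad : ∀ w, MemLp (G w) p (volume.restrict (exterior N))
  hasWeakGradient : ∀ w, HasWeakGradient (exterior N) (U w) (G w)
  add_ae : ∀ v w, U (v + w) =ᵐ[volume.restrict (exterior N)] fun x => U v x + U w x
  smul_ae : ∀ (c : ℝ) w, U (c • w) =ᵐ[volume.restrict (exterior N)] fun x => c * U w x
  energy_eq : ∀ w, (∫⁻ x in exterior N, ‖U w x‖ₑ ^ p.toReal) +
    ∫⁻ x in exterior N, ‖G w x‖ₑ ^ p.toReal = ‖w‖ₑ ^ p.toReal

theorem isSobolevFamily_sobolevSpace (N : ℕ) {p : ℝ≥0∞} [Fact (1 ≤ p)] (hp : p ≠ ⊤) :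
    IsSobolevFamily p (fun w : sobolevSpace (exterior N) p => (w.1.fst : _ → ℝ))
      (fun w => (w.1.snd : _ → EuclideanSpace ℝ (Fin N))) where
  measurable_fun _ := (Lp.stronglyMeasurable _).measurable
  measurable_grad _ := (Lp.stronglyMeasurable _).measurable
  memLp_fun _ := Lp.memLp _
  memLp_grad _ := Lp.memLp _
  hasWeakGradient w := w.2
  add_ae v w := Lp.coeFn_add v.1.fst w.1.fst
  smul_ae c w := Lp.coeFn_smul c w.1.fst
  energy_eq w := by
    have h1 : (1 : ℝ≥0∞) ≤ p := Fact.out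
    have hq : 0 < p.toReal := ENNReal.toReal_pos (zero_lt_one.trans_le h1).ne' hp
    rw [lintegral_rpow_enorm_Lp hp, lintegral_rpow_enorm_Lp hp]
    have h2 : ‖w‖ ^ p.toReal = ‖w.1.fst‖ ^ p.toReal + ‖w.1.snd‖ ^ p.toReal := by
      rw [show ‖w‖ = ‖w.1‖ from rfl, WithLp.prod_norm_eq_add hq, ← Real.rpow_mul (by positivity),
        one_div_mul_cancel hq.ne', Real.rpow_one]
    simp only [← ofReal_norm, ENNReal.ofReal_rpow_of_nonneg (norm_nonneg _) hq.le]
    rw [h2, ENNReal.ofReal_add (by positivity) (by positivity)]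

/-! ### The weighted measure, the embedding and the averaging functionals -/

section Weight

variable {N : ℕ}

theorem weightMeasure_absolutelyContinuous (g : EuclideanSpace ℝ (Fin N) → ℝ) :
    weightMeasure g ≪ volume.restrict (exterior N) :=
  withDensity_absolutelyContinuous _ _

theorem lintegral_weightMeasure {g : EuclideanSpace ℝ (Fin N) → ℝ}
    (hg : LocallyIntegrableOn g (exterior N)) {f : EuclideanSpace ℝ (Fin N) → ℝ≥0∞}
    (hf : AEMeasurable f (volume.restrict (exterior N))) :
    ∫⁻ x, f x ∂(weightMeasure g) = ∫⁻ x in exterior N, ‖g x‖ₑ * f x :=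
  lintegral_withDensity_eq_lintegral_mul₀ hg.aestronglyMeasurable.enorm hf

end Weight

/-- The finite rank operator with values in the functions that are constant on the level sets
of a simple function. -/
theorem exists_finiteRank {p : ℝ≥0∞} [Fact (1 ≤ p)] {F X : Type*} [NormedAddCommGroup F] [NormedSpace ℝ F]
    [MeasurableSpace X] {μ : Measure X} {Y : Type*} (f : SimpleFunc X Y) {A : Set X}
    (hA : MeasurableSet A) (hμA : μ A ≠ ⊤) (ℓ : Y → F →L[ℝ] ℝ) :
    ∃ S : F →L[ℝ] Lp ℝ p μ, IsCompactOperator S ∧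
      ∀ w, S w =ᵐ[μ] A.indicator fun x => ℓ (f x) w := by
  classical
  have hm : ∀ y, MeasurableSet (A ∩ f ⁻¹' {y}) := fun y => hA.inter (f.measurableSet_fiber y)
  have hf : ∀ y, μ (A ∩ f ⁻¹' {y}) ≠ ⊤ := fun y => measure_ne_top_of_subset inter_subset_left hμA
  let S : Y → F →L[ℝ] Lp ℝ p μ := fun y =>
    (ContinuousLinearMap.toSpanSingleton ℝ (indicatorConstLp p (hm y) (hf y) (1 : ℝ))).comp (ℓ y)
  have hSc : ∀ y, IsCompactOperator (S y) := fun y =>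
    (isCompactOperator_of_locallyCompactSpace_dom (ℓ y)).clm_comp
      (ContinuousLinearMap.toSpanSingleton ℝ (indicatorConstLp p (hm y) (hf y) (1 : ℝ)))
  have hSw : ∀ (y : Y) (w : F),
      S y w =ᵐ[μ] fun x => ℓ y w * (A ∩ f ⁻¹' {y}).indicator (fun _ => (1 : ℝ)) x := by
    intro y w
    have h1 : S y w = ℓ y w • indicatorConstLp p (hm y) (hf y) (1 : ℝ) := rfl
    rw [h1]
    filter_upwards [Lp.coeFn_smul (ℓ y w) (indicatorConstLp p (hm y) (hf y) (1 : ℝ)),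
      indicatorConstLp_coeFn (p := p) (hs := hm y) (hμs := hf y) (c := (1 : ℝ))] with x hx hx'
    rw [hx, Pi.smul_apply, hx', smul_eq_mul]
  refine ⟨∑ y ∈ f.range, S y, ?_, fun w => ?_⟩
  · exact Submodule.sum_mem (compactOperator (RingHom.id ℝ) F (Lp ℝ p μ)) fun y _ => hSc y
  · have hsum : ∀ s : Finset Y, (∑ y ∈ s, S y) w =ᵐ[μ] fun x =>
        ∑ y ∈ s, ℓ y w * (A ∩ f ⁻¹' {y}).indicator (fun _ => (1 : ℝ)) x := by
      intro s
      induction s using Finset.induction_on with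
      | empty => exact Lp.coeFn_zero ℝ p μ
      | insert y s hy ih =>
        rw [Finset.sum_insert hy, add_apply]
        filter_upwards [Lp.coeFn_add (S y w) ((∑ y ∈ s, S y) w), ih, hSw y w] with x h1 h2 h3
        rw [h1, Pi.add_apply, h2, h3, Finset.sum_insert hy]
    filter_upwards [hsum f.range] with x hx
    rw [hx, Finset.sum_eq_single (f x)]
    · by_cases hxA : x ∈ A <;> simp [hxA]
    · intro y _ hy
      rw [indicator_of_notMem (fun h => hy h.2.symm), mul_zero]
    · intro h
      exact absurd (f.mem_range_self x) h

namespace IsSobolevFamily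

variable {N : ℕ} {p : ℝ≥0∞} [Fact (1 ≤ p)] {F : Type*} [NormedAddCommGroup F] [NormedSpace ℝ F]
  {U : F → EuclideanSpace ℝ (Fin N) → ℝ}
  {G : F → EuclideanSpace ℝ (Fin N) → EuclideanSpace ℝ (Fin N)}

/-- Stated for an arbitrary radial weight because it serves twice: with `γ` for boundedness, and
with the tail of `γ` for compactness. -/
theorem lintegral_radial_weight_fst_le (hU : IsSobolevFamily p U G) (hN : 1 ≤ N) (hp : p ≠ ⊤)
    {γ : ℝ → ℝ≥0∞} (hγ : Measurable γ) (w : F) :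
    ∫⁻ x in exterior N, γ ‖x‖ * ‖U w x‖ₑ ^ p.toReal ≤
      2 ^ (p.toReal - 1) * (∫⁻ r in Ioi 1, γ r) * ‖w‖ₑ ^ p.toReal := by
  have h1 : (1 : ℝ≥0∞) ≤ p := Fact.out
  have hq : 1 ≤ p.toReal := by simpa using ENNReal.toReal_mono hp h1
  rw [← hU.energy_eq w]
  exact lintegral_radial_weight_le hN h1 hq (hU.measurable_fun w) (hU.measurable_grad w) (hU.memLp_fun w)
    (hU.memLp_grad w) (hU.hasWeakGradient w) hγ

/-- The embedding of the Sobolev space into the weighted `L^p` space. -/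
theorem exists_embedding (hU : IsSobolevFamily p U G) (hN : 1 ≤ N) (hp : p ≠ ⊤) {g : EuclideanSpace ℝ (Fin N) → ℝ}
    (hg : LocallyIntegrableOn g (exterior N)) {γ : ℝ → ℝ≥0∞} (hγ : Measurable γ)
    (hγi : ∫⁻ r in Ioi 1, γ r ≠ ⊤) (hgγ : ∀ᵐ x, x ∈ exterior N → ‖g x‖ₑ ≤ γ ‖x‖) :
    ∃ T : F →L[ℝ] Lp ℝ p (weightMeasure g),
      ∀ w, T w =ᵐ[weightMeasure g] U w := by
  have h1 : (1 : ℝ≥0∞) ≤ p := Fact.out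
  have h0 : p ≠ 0 := (zero_lt_one.trans_le h1).ne'
  have hq0 : 0 < p.toReal := ENNReal.toReal_pos h0 hp
  have hΩ : MeasurableSet (exterior N) := (isOpen_exterior N).measurableSet
  set C : ℝ≥0∞ := 2 ^ (p.toReal - 1) * ∫⁻ r in Ioi 1, γ r with hC
  have hq : 1 ≤ p.toReal := by simpa using ENNReal.toReal_mono hp h1
  have hCt : C ≠ ⊤ := ENNReal.mul_ne_top
    (ENNReal.rpow_ne_top_of_nonneg (by linarith) ENNReal.ofNat_ne_top) hγi
  have hac := weightMeasure_absolutelyContinuous g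
  have hle : ∀ w : F,
      ∫⁻ x, ‖U w x‖ₑ ^ p.toReal ∂(weightMeasure g) ≤ C * ‖w‖ₑ ^ p.toReal := by
    intro w
    rw [lintegral_weightMeasure hg ((hU.measurable_fun w).enorm.pow_const _).aemeasurable]
    refine le_trans (lintegral_mono_ae ?_) (hU.lintegral_radial_weight_fst_le hN hp hγ w)
    filter_upwards [(ae_restrict_iff' hΩ).2 hgγ] with x hx
    gcongr
  have hmem : ∀ w : F, MemLp (U w) p (weightMeasure g) := by
    intro w
    refine ⟨(hU.measurable_fun w).aestronglyMeasurable, ?_⟩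
    rw [eLpNorm_lt_top_iff_lintegral_rpow_enorm_lt_top h0 hp]
    exact (hle w).trans_lt (ENNReal.mul_lt_top hCt.lt_top
      (ENNReal.rpow_lt_top_of_nonneg hq0.le enorm_ne_top))
  exact exists_clm_Lp hp hCt hmem
    (fun v w => hac.ae_le (hU.add_ae v w)) (fun c w => hac.ae_le (hU.smul_ae c w)) hle

/-- The average over a ball contained in the domain is a continuous linear functional. -/
theorem exists_average_clm (hU : IsSobolevFamily p U G) (hN : 1 ≤ N) (hp : p ≠ ⊤) (y : EuclideanSpace ℝ (Fin N)) {h : ℝ}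
    (hh : 0 < h) : ∃ ℓ : F →L[ℝ] ℝ,
      Metric.ball y h ⊆ exterior N → ∀ w, ℓ w = ⨍ t in Metric.ball y h, U w t := by
  -- For balls leaving the domain the functional is the default `0`, so that a functional exists for
  -- every centre and can be chosen as a function of `y`.
  by_cases hB : Metric.ball y h ⊆ exterior N
  swap
  · exact ⟨0, fun h => absurd h hB⟩
  have : Nonempty (Fin N) := ⟨⟨0, hN⟩⟩
  have h1 : (1 : ℝ≥0∞) ≤ p := Fact.out
  have hq : 1 ≤ p.toReal := by simpa using ENNReal.toReal_mono hp h1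
  have hq0 : 0 < p.toReal := by positivity
  set b := volume (Metric.ball y h) with hb
  have hb0 : b ≠ 0 := (Metric.measure_ball_pos volume _ hh).ne'
  have hbt : b ≠ ⊤ := measure_ball_lt_top.ne
  obtain ⟨κ, hκ⟩ : ∃ κ, κ = b⁻¹ • volume.restrict (Metric.ball y h) := ⟨_, rfl⟩
  have hκp : IsProbabilityMeasure κ := ⟨by
    rw [hκ, Measure.smul_apply, Measure.restrict_apply_univ, smul_eq_mul,
      ENNReal.inv_mul_cancel hb0 hbt]⟩
  -- This domination by a finite multiple of Lebesgue measure transfers integrability, null sets and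
  -- the norm bound to the average.
  have hκle : κ ≤ b⁻¹ • volume.restrict (exterior N) :=
    hκ ▸ Measure.le_iff'.2 fun s => mul_le_mul' le_rfl (Measure.restrict_mono hB le_rfl s)
  have hac : κ ≪ volume.restrict (exterior N) :=
    hκle.absolutelyContinuous.trans Measure.smul_absolutelyContinuous
  have hint : ∀ w : F, Integrable (U w) κ := fun w =>
    ((hU.memLp_fun w).of_measure_le_smul (ENNReal.inv_ne_top.2 hb0) hκle).integrable h1
  have hle : ∀ w : F,
      ∫⁻ t, ‖U w t‖ₑ ^ p.toReal ∂κ ≤ b⁻¹ * ‖w‖ₑ ^ p.toReal := by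
    intro w
    have h2 : ∫⁻ t, ‖U w t‖ₑ ^ p.toReal ∂κ ≤
        ∫⁻ t, ‖U w t‖ₑ ^ p.toReal ∂(b⁻¹ • volume.restrict (exterior N)) :=
      lintegral_mono' hκle (le_refl _)
    have h3 : ∫⁻ t in exterior N, ‖U w t‖ₑ ^ p.toReal ≤ ‖w‖ₑ ^ p.toReal :=
      le_self_add.trans_eq (hU.energy_eq w)
    rw [lintegral_smul_measure] at h2
    exact h2.trans (mul_le_mul' le_rfl h3)
  obtain ⟨ℓ, hℓ⟩ := exists_clm_integral hq
    (ENNReal.inv_ne_top.2 hb0) hint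
    (fun v w => hac.ae_le (hU.add_ae v w)) (fun c w => hac.ae_le (hU.smul_ae c w))
    hle
  refine ⟨ℓ, fun _ w => ?_⟩
  rw [hℓ w, hκ, average, Measure.restrict_apply_univ]

end IsSobolevFamily

/-! ### Truncation of the weight and choice of the parameters -/

/-- The radii that stay away from `1` and `∞` and at which the weight is bounded. -/
def goodRadii (γ : ℝ → ℝ≥0∞) (n : ℕ) : Set ℝ :=
  {r | 1 + 1 / ((n : ℝ) + 1) ≤ r ∧ r ≤ n ∧ γ r ≤ n}

theorem measurableSet_goodRadii {γ : ℝ → ℝ≥0∞} (hγ : Measurable γ) (n : ℕ) :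
    MeasurableSet (goodRadii γ n) :=
  (measurableSet_le measurable_const measurable_id).inter
    ((measurableSet_le measurable_id measurable_const).inter
      (measurableSet_le hγ measurable_const))

/-- An integrable `γ` is finite almost everywhere, so almost every `r > 1` is good for large `n`;
dominated convergence applies with majorant `γ`. -/
theorem tendsto_lintegral_compl_goodRadii {γ : ℝ → ℝ≥0∞} (hγ : Measurable γ)
    (hγi : ∫⁻ r in Ioi 1, γ r ≠ ⊤) :
    Tendsto (fun n => ∫⁻ r in Ioi 1, (goodRadii γ n)ᶜ.indicator γ r) atTop (𝓝 0) := by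
  have h := tendsto_lintegral_of_dominated_convergence (μ := volume.restrict (Ioi (1 : ℝ)))
    (F := fun n => (goodRadii γ n)ᶜ.indicator γ) (f := fun _ => 0) γ
    (fun n => hγ.indicator (measurableSet_goodRadii hγ n).compl)
    (fun n => Eventually.of_forall fun r => indicator_le_self _ _ _) hγi ?_
  · simpa using h
  filter_upwards [ae_lt_top hγ hγi, ae_restrict_mem measurableSet_Ioi] with r hr hr1
  refine tendsto_const_nhds.congr' ?_
  have h1 : Tendsto (fun n : ℕ => 1 + 1 / ((n : ℝ) + 1)) atTop (𝓝 (1 + 0)) :=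
    tendsto_one_div_add_atTop_nhds_zero_nat.const_add 1
  rw [add_zero] at h1
  obtain ⟨m, hm⟩ := ENNReal.exists_nat_gt hr.ne
  filter_upwards [h1.eventually (gt_mem_nhds hr1), eventually_ge_atTop ⌈r⌉₊,
    eventually_ge_atTop m] with n h2 h3 h4
  rw [indicator_of_notMem]
  refine notMem_compl_iff.2 ⟨h2.le, Nat.ceil_le.1 h3, hm.le.trans ?_⟩
  exact_mod_cast h4

/-- A bounded set can be mapped to finitely many of its nearby points by a simple function. -/
theorem exists_simpleFunc_near {E : Type*} [NormedAddCommGroup E] [ProperSpace E]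
    [MeasurableSpace E] [OpensMeasurableSpace E] (R : ℝ) {h : ℝ} (hh : 0 < h) :
    ∃ f : SimpleFunc E E, ∀ x, ‖x‖ ≤ R → ‖x - f x‖ < h := by
  have hcov : Metric.closedBall (0 : E) R ⊆ ⋃ k, Metric.ball (TopologicalSpace.denseSeq E k) h := by
    intro x _
    obtain ⟨k, hk⟩ := (TopologicalSpace.denseRange_denseSeq E).exists_dist_lt x hh
    exact mem_iUnion.2 ⟨k, hk⟩
  obtain ⟨t, ht⟩ := (isCompact_closedBall (0 : E) R).elim_finite_subcover _
    (fun _ => Metric.isOpen_ball) hcov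
  -- `t.sup id` is the largest index in the finite subcover, so the nearest point is taken among all
  -- its centres.
  refine ⟨SimpleFunc.nearestPt (TopologicalSpace.denseSeq E) (t.sup id), fun x hx => ?_⟩
  obtain ⟨k, hk, hxk⟩ := mem_iUnion₂.1 (ht (mem_closedBall_zero_iff.2 hx))
  have h1 := SimpleFunc.edist_nearestPt_le (TopologicalSpace.denseSeq E) x
    (Finset.le_sup (f := id) hk)
  rw [edist_dist, edist_dist, ENNReal.ofReal_le_ofReal_iff dist_nonneg] at h1
  rw [Metric.mem_ball, dist_comm] at hxk
  rw [← dist_eq_norm, dist_comm]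
  exact h1.trans_lt hxk

theorem exists_pos_radius {C c : ℝ≥0∞} (hC : C ≠ ⊤) (hc : 0 < c) {q : ℝ} (hq : 0 < q) {δ : ℝ}
    (hδ : 0 < δ) : ∃ h : ℝ, 0 < h ∧ 4 * h ≤ δ ∧ C * ENNReal.ofReal (2 * h) ^ q ≤ c := by
  have h1 : Tendsto (fun h : ℝ => C * ENNReal.ofReal (2 * h) ^ q) (𝓝[>] 0) (𝓝 0) := by
    have h2 : Continuous fun h : ℝ => ENNReal.ofReal (2 * h) ^ q :=
      (ENNReal.continuous_rpow_const).comp (ENNReal.continuous_ofReal.comp (by fun_prop))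
    have h3 := ENNReal.Tendsto.const_mul (a := C) (h2.tendsto 0) (Or.inr hC)
    simp only [mul_zero, ENNReal.ofReal_zero, ENNReal.zero_rpow_of_pos hq] at h3
    exact h3.mono_left nhdsWithin_le_nhds
  have h4 : ∀ᶠ h : ℝ in 𝓝[>] 0, h < δ / 4 :=
    nhdsWithin_le_nhds (gt_mem_nhds (by positivity))
  obtain ⟨h, h5, h6, h7⟩ := ((h1.eventually (gt_mem_nhds hc)).and
    (h4.and self_mem_nhdsWithin)).exists
  exact ⟨h, h7, by linarith, h5.le⟩

theorem weightMeasure_lt_top {N : ℕ} {g : EuclideanSpace ℝ (Fin N) → ℝ} {γ : ℝ → ℝ≥0∞}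
    (hγ : Measurable γ) (hgγ : ∀ᵐ x, x ∈ exterior N → ‖g x‖ₑ ≤ γ ‖x‖) (n : ℕ) :
    weightMeasure g {x | ‖x‖ ∈ goodRadii γ n} < ⊤ := by
  have hΩ : MeasurableSet (exterior N) := (isOpen_exterior N).measurableSet
  have hA : MeasurableSet {x : EuclideanSpace ℝ (Fin N) | ‖x‖ ∈ goodRadii γ n} :=
    measurable_norm (measurableSet_goodRadii hγ n)
  rw [weightMeasure, withDensity_apply _ hA]
  calc ∫⁻ x in {x | ‖x‖ ∈ goodRadii γ n}, ‖g x‖ₑ ∂(volume.restrict (exterior N))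
      ≤ ∫⁻ _ in {x | ‖x‖ ∈ goodRadii γ n}, (n : ℝ≥0∞) ∂(volume.restrict (exterior N)) := by
        refine lintegral_mono_ae ?_
        filter_upwards [ae_restrict_of_ae ((ae_restrict_iff' hΩ).2 hgγ), ae_restrict_mem hA]
          with x hx hxA
        exact hx.trans hxA.2.2
    _ ≤ n * volume (Metric.closedBall (0 : EuclideanSpace ℝ (Fin N)) n) := by
        rw [setLIntegral_const]
        refine mul_le_mul' le_rfl ?_
        refine (Measure.restrict_apply_le _ _).trans (measure_mono fun x hx => ?_)
        exact mem_closedBall_zero_iff.2 hx.2.1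
    _ < ⊤ := ENNReal.mul_lt_top (ENNReal.natCast_lt_top n) measure_closedBall_lt_top

/-! ### Compactness by finite rank approximation -/

namespace IsSobolevFamily

variable {N : ℕ} {p : ℝ≥0∞} [Fact (1 ≤ p)] {F : Type*} [NormedAddCommGroup F] [NormedSpace ℝ F]
  {U : F → EuclideanSpace ℝ (Fin N) → ℝ}
  {G : F → EuclideanSpace ℝ (Fin N) → EuclideanSpace ℝ (Fin N)}

/-- The local error of the averages and the tail of the weight control the weighted distance. -/
theorem lintegral_weight_sub_le (hU : IsSobolevFamily p U G) (hN : 1 ≤ N) (hp : p ≠ ⊤) {g : EuclideanSpace ℝ (Fin N) → ℝ}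
    {γ : ℝ → ℝ≥0∞} (hγ : Measurable γ)
    (hgγ : ∀ᵐ x, x ∈ exterior N → ‖g x‖ₑ ≤ γ ‖x‖) {n : ℕ} {h : ℝ} (hh : 0 < h)
    (hhn : 4 * h ≤ 1 / ((n : ℝ) + 1))
    {f : EuclideanSpace ℝ (Fin N) → EuclideanSpace ℝ (Fin N)}
    (hf : ∀ x, ‖x‖ ≤ n → ‖x - f x‖ < h) (w : F) :
    ∫⁻ x in exterior N, ‖g x‖ₑ * ‖U w x - {x | ‖x‖ ∈ goodRadii γ n}.indicator
        (fun x => ⨍ t in Metric.ball (f x) h, U w t) x‖ₑ ^ p.toReal ≤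
      (2 ^ (p.toReal - 1) * (∫⁻ r in Ioi 1, (goodRadii γ n)ᶜ.indicator γ r) +
        n * 2 ^ N * ENNReal.ofReal (2 * h) ^ p.toReal) * ‖w‖ₑ ^ p.toReal := by
  have h1 : (1 : ℝ≥0∞) ≤ p := Fact.out
  have hq : 1 ≤ p.toReal := by simpa using ENNReal.toReal_mono hp h1
  have hΩ : MeasurableSet (exterior N) := (isOpen_exterior N).measurableSet
  have hJ := measurableSet_goodRadii hγ n
  have hJc : Measurable ((goodRadii γ n)ᶜ.indicator γ) := hγ.indicator hJ.compl
  set A : Set (EuclideanSpace ℝ (Fin N)) := {x | ‖x‖ ∈ goodRadii γ n} with hAdef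
  have hA : MeasurableSet A := measurable_norm hJ
  have hAδ : ∀ x ∈ A, 1 + 4 * h ≤ ‖x‖ := fun x hx => le_trans (by linarith) hx.1
  set u := U w with hu
  have hum : Measurable u := hU.measurable_fun w
  set v : EuclideanSpace ℝ (Fin N) → ℝ := fun x => ⨍ t in Metric.ball (f x) h, u t with hv
  have hloc : ∫⁻ x in A, ‖u x - v x‖ₑ ^ p.toReal ≤
      2 ^ N * ENNReal.ofReal (2 * h) ^ p.toReal * ‖w‖ₑ ^ p.toReal := by
    refine (lintegral_sub_average_le hN h1 hq hum (hU.measurable_grad w) (hU.memLp_fun w)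
      (hU.memLp_grad w) (hU.hasWeakGradient w) hA hh hAδ fun x hx => hf x hx.2.1).trans (mul_le_mul' le_rfl ?_)
    exact le_add_self.trans_eq (hU.energy_eq w)
  have hmT : Measurable fun x => (goodRadii γ n)ᶜ.indicator γ ‖x‖ * ‖u x‖ₑ ^ p.toReal :=
    (hJc.comp measurable_norm).mul (hum.enorm.pow_const _)
  calc ∫⁻ x in exterior N, ‖g x‖ₑ * ‖u x - A.indicator v x‖ₑ ^ p.toReal
      ≤ ∫⁻ x in exterior N, ((goodRadii γ n)ᶜ.indicator γ ‖x‖ * ‖u x‖ₑ ^ p.toReal +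
          A.indicator (fun x => n * ‖u x - v x‖ₑ ^ p.toReal) x) := by
        refine lintegral_mono_ae ?_
        filter_upwards [(ae_restrict_iff' hΩ).2 hgγ] with x hx
        -- On `A` the weight is at most `n` and only the averaging error remains; off `A` the
        -- approximant vanishes and only the tail of `γ` remains.
        by_cases hxA : x ∈ A
        · have hxJ : ‖x‖ ∈ goodRadii γ n := hxA
          rw [indicator_of_mem hxA, indicator_of_mem hxA]
          refine le_trans ?_ le_add_self
          exact mul_le_mul' (hx.trans hxJ.2.2) le_rfl
        · have hxJ : ‖x‖ ∈ (goodRadii γ n)ᶜ := hxA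
          rw [indicator_of_notMem hxA, indicator_of_notMem hxA, indicator_of_mem hxJ, sub_zero,
            add_zero]
          exact mul_le_mul' hx le_rfl
    _ = (∫⁻ x in exterior N, (goodRadii γ n)ᶜ.indicator γ ‖x‖ * ‖u x‖ₑ ^ p.toReal) +
        ∫⁻ x in exterior N, A.indicator (fun x => n * ‖u x - v x‖ₑ ^ p.toReal) x :=
        lintegral_add_left hmT _
    _ ≤ 2 ^ (p.toReal - 1) * (∫⁻ r in Ioi 1, (goodRadii γ n)ᶜ.indicator γ r) *
          ‖w‖ₑ ^ p.toReal +
        n * (2 ^ N * ENNReal.ofReal (2 * h) ^ p.toReal * ‖w‖ₑ ^ p.toReal) := by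
        refine add_le_add (hU.lintegral_radial_weight_fst_le hN hp hJc w) ?_
        refine (setLIntegral_le_lintegral _ _).trans ?_
        rw [lintegral_indicator hA, lintegral_const_mul' _ _ (ENNReal.natCast_ne_top n)]
        exact mul_le_mul' le_rfl hloc
    _ = _ := by ring

theorem isCompactOperator_embedding (hU : IsSobolevFamily p U G) (hN : 1 ≤ N) (hp : p ≠ ⊤)
    {g : EuclideanSpace ℝ (Fin N) → ℝ} (hg : LocallyIntegrableOn g (exterior N))
    {γ : ℝ → ℝ≥0∞} (hγ : Measurable γ) (hγi : ∫⁻ r in Ioi 1, γ r ≠ ⊤)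
    (hgγ : ∀ᵐ x, x ∈ exterior N → ‖g x‖ₑ ≤ γ ‖x‖)
    (T : F →L[ℝ] Lp ℝ p (weightMeasure g))
    (hT : ∀ w, T w =ᵐ[weightMeasure g] U w) : IsCompactOperator T := by
  have h1 : (1 : ℝ≥0∞) ≤ p := Fact.out
  have hq : 1 ≤ p.toReal := by simpa using ENNReal.toReal_mono hp h1
  have hq0 : 0 < p.toReal := by positivity
  refine isCompactOperator_of_approx hq0 T fun c hc hct => ?_
  have hc2 : 0 < c / 2 := ENNReal.half_pos hc.ne'
  have htail : Tendsto (fun n => 2 ^ (p.toReal - 1) *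
      ∫⁻ r in Ioi 1, (goodRadii γ n)ᶜ.indicator γ r) atTop (𝓝 0) := by
    have := ENNReal.Tendsto.const_mul (a := (2 : ℝ≥0∞) ^ (p.toReal - 1))
      (tendsto_lintegral_compl_goodRadii hγ hγi)
      (Or.inr (ENNReal.rpow_ne_top_of_nonneg (by linarith) ENNReal.ofNat_ne_top))
    rwa [mul_zero] at this
  -- The tail fixes `n`; only then is `h` chosen, small enough to beat the factor `n * 2 ^ N` of the
  -- averaging error and to keep the balls inside the domain.
  obtain ⟨n, hn⟩ := (htail.eventually (gt_mem_nhds hc2)).exists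
  obtain ⟨h, hh, hhn, hhc⟩ := exists_pos_radius (C := n * 2 ^ N)
    (ENNReal.mul_ne_top (ENNReal.natCast_ne_top n) (ENNReal.pow_ne_top ENNReal.ofNat_ne_top))
    hc2 hq0 (Nat.one_div_pos_of_nat (n := n) : (0 : ℝ) < 1 / ((n : ℝ) + 1))
  obtain ⟨f, hf⟩ := exists_simpleFunc_near (E := EuclideanSpace ℝ (Fin N)) n hh
  choose ℓ hℓ using fun y => hU.exists_average_clm hN hp y hh
  have hA : MeasurableSet {x : EuclideanSpace ℝ (Fin N) | ‖x‖ ∈ goodRadii γ n} :=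
    measurable_norm (measurableSet_goodRadii hγ n)
  obtain ⟨S, hSc, hS⟩ := exists_finiteRank (p := p) f hA
    (weightMeasure_lt_top hγ hgγ n).ne ℓ
  refine ⟨S, hSc, fun w => ?_⟩
  have hball : ∀ x : EuclideanSpace ℝ (Fin N), ‖x‖ ∈ goodRadii γ n →
      Metric.ball (f x) h ⊆ exterior N := by
    intro x hx t ht
    rw [mem_ball_iff_norm, norm_sub_rev] at ht
    have h2 : ‖x‖ ≤ ‖x - f x‖ + (‖f x - t‖ + ‖t‖) := by
      calc ‖x‖ = ‖(x - f x) + ((f x - t) + t)‖ := by congr 1; abel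
        _ ≤ _ := (norm_add_le _ _).trans (by gcongr; exact norm_add_le _ _)
    rw [mem_exterior]
    linarith [hf x hx.2.1, hx.1]
  set v : EuclideanSpace ℝ (Fin N) → ℝ := {x | ‖x‖ ∈ goodRadii γ n}.indicator
        (fun x => ⨍ t in Metric.ball (f x) h, U w t) with hv
  have hvS : S w =ᵐ[weightMeasure g] v := by
    filter_upwards [hS w] with x hx
    rw [hx, hv]
    by_cases hxA : ‖x‖ ∈ goodRadii γ n
    · rw [indicator_of_mem (show x ∈ {x | ‖x‖ ∈ goodRadii γ n} from hxA),
        indicator_of_mem (show x ∈ {x | ‖x‖ ∈ goodRadii γ n} from hxA), hℓ _ (hball x hxA)]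
    · rw [indicator_of_notMem (show x ∉ {x | ‖x‖ ∈ goodRadii γ n} from hxA),
        indicator_of_notMem (show x ∉ {x | ‖x‖ ∈ goodRadii γ n} from hxA)]
  -- Since `f` is simple, the average over the ball about `f x` takes finitely many values, on
  -- measurable level sets.
  have hvm : Measurable v :=
    ((f.map fun y => ⨍ t in Metric.ball y h, U w t).measurable).indicator hA
  rw [← lintegral_rpow_enorm_Lp hp]
  calc ∫⁻ x, ‖(T w - S w) x‖ₑ ^ p.toReal ∂(weightMeasure g)
      = ∫⁻ x, ‖U w x - v x‖ₑ ^ p.toReal ∂(weightMeasure g) := by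
        refine lintegral_congr_ae ?_
        filter_upwards [Lp.coeFn_sub (T w) (S w), hT w, hvS] with x h2 h3 h4
        rw [h2, Pi.sub_apply, h3, h4]
    _ = ∫⁻ x in exterior N, ‖g x‖ₑ * ‖U w x - v x‖ₑ ^ p.toReal :=
        lintegral_weightMeasure hg
          (((hU.measurable_fun w).sub hvm).enorm.pow_const _).aemeasurable
    _ ≤ _ := hU.lintegral_weight_sub_le hN hp hγ hgγ hh hhn hf w
    _ ≤ (c / 2 + c / 2) * ‖w‖ₑ ^ p.toReal :=
        mul_le_mul' (add_le_add hn.le hhc) le_rfl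
    _ = c * ‖w‖ₑ ^ p.toReal := by rw [ENNReal.add_halves]

theorem exists_compact_embedding (hU : IsSobolevFamily p U G) (hN : 1 ≤ N) (hp : p ≠ ⊤)
    {g : EuclideanSpace ℝ (Fin N) → ℝ} (hg : LocallyIntegrableOn g (exterior N))
    {γ : ℝ → ℝ≥0∞} (hγ : Measurable γ) (hγi : ∫⁻ r in Ioi 1, γ r ≠ ⊤)
    (hgγ : ∀ᵐ x, x ∈ exterior N → ‖g x‖ₑ ≤ γ ‖x‖) :
    ∃ T : F →L[ℝ] Lp ℝ p (weightMeasure g),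
      (∀ w, T w =ᵐ[weightMeasure g] U w) ∧ IsCompactOperator T := by
  obtain ⟨T, hT⟩ := hU.exists_embedding hN hp hg hγ hγi hgγ
  exact ⟨T, hT, hU.isCompactOperator_embedding hN hp hg hγ hγi hgγ T hT⟩

end IsSobolevFamily

end ExteriorBall

end

theorem mainTheorem6 (N : ℕ) (hN : 1 ≤ N) (p : ℝ≥0∞) [Fact (1 ≤ p)] (hp1 : 1 < p) (hp : p ≠ ⊤)
    (g : EuclideanSpace ℝ (Fin N) → ℝ)
    (hg : LocallyIntegrableOn g (ExteriorBall.exterior N))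
    (hgX : ExteriorBall.MemX N p (ExteriorBall.radialEnvelope g)) :
    ∃ T : ExteriorBall.sobolevSpace (ExteriorBall.exterior N) p →L[ℝ]
        Lp ℝ p (ExteriorBall.weightMeasure g),
      (∀ w : ExteriorBall.sobolevSpace (ExteriorBall.exterior N) p,
        T w =ᵐ[ExteriorBall.weightMeasure g] w.1.fst) ∧
      IsCompactOperator T := by
  have hU := ExteriorBall.isSobolevFamily_sobolevSpace N hp
  obtain ⟨γ, hγ, hγi, hgγ⟩ := ExteriorBall.exists_radial_majorant hN hp1.le hp hg hgX
  exact hU.exists_compact_embedding hN hp hg hγ hγi hgγ
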